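/- Let $0<c<\tfrac14$, $\omega>0$ and $p>1$. Let $\mathbb{R}^+=(0,\infty)$ and let $H^1_0(\mathbb{R}^+)$ be the closure of $C_c^\infty((0,\infty);\mathbb{C})$ in the Sobolev space $H^1(\mathbb{R}^+;\mathbb{C})$. For $u\in H^1_0(\mathbb{R}^+)$ put \[ S(u)=\tfrac12\|u'\|_{L^2}^2-\tfrac c2\Big\|\frac ux\Big\|_{L^2}^2+\tfrac\omega2\|u\|_{L^2}^2-\tfrac1{p+1}\|u\|_{L^{p+1}}^{p+1}, \] \[ J(u)=\int_0^\infty\Big(|u'|^2-\frac{c}{x^2}|u|^2\Big)dx+\omega\|u\|_{L^2}^2-\|u\|_{L^{p+1}}^{p+1}, \] all norms being taken over $\mathbb{R}^+$, and let \[ \mathcal N=\{u\in H^1_0(\mathbb{R}^+)\setminus\{0\}: J(u)=0\},\qquad m=\inf\{S(u):u\in\mathcal N\}. \] Then $u/x\in L^2(\mathbb{R}^+)$ and $u\in L^{p+1}(\mathbb{R}^+)$ for every $u\in H^1_0(\mathbb{R}^+)$ (so that $S$ and $J$ are well defined), $S$ is bounded below on $\mathcal N$, and there exists $u\in\mathcal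 N$ (in particular $u\ne0$) with $u\ge 0$ a.e. and $S(u)=m$. Moreover this $u$ is a nontrivial solution in $H^1_0(\mathbb{R}^+)$ of the stationary equation \[ \varphi''+\frac{c}{x^2}\varphi-\omega\varphi+|\varphi|^{p-1}\varphi=0 \] in $H^{-1}(\mathbb{R}^+)$, the dual of $H^1_0(\mathbb{R}^+)$, that is, for all $v\in H^1_0(\mathbb{R}^+)$, \[ \int_0^\infty\Big(\varphi'\,\overline{v'}-\frac{c}{x^2}\varphi\,\overline v+\omega\varphi\,\overline v-|\varphi|^{p-1}\varphi\,\overline v\Big)dx=0 . \] -/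

import Mathlib

open MeasureTheory Set
open scoped ComplexConjugate

namespace HalfLineNLS

/-- Lebesgue measure on the half-line `ℝ⁺ = (0, ∞)`. -/
noncomputable abbrev halfLine : Measure ℝ := volume.restrict (Ioi (0 : ℝ))

/-- `φ ∈ C_c^∞((0, ∞); ℂ)`, extended by zero to the real line. -/
structure IsTest (φ : ℝ → ℂ) : Prop where
  smooth : ContDiff ℝ ((⊤ : ℕ∞) : WithTop ℕ∞) φ
  compact : HasCompactSupport φ
  support : tsupport φ ⊆ Ioi (0 : ℝ)

/-- `v` is the weak derivative of `u` on `(0, ∞)`. -/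
def IsWeakDeriv (u v : ℝ → ℂ) : Prop :=
  ∀ φ : ℝ → ℂ, IsTest φ →
    ∫ x, u x * deriv φ x ∂halfLine = - ∫ x, v x * φ x ∂halfLine

/-- `L²(ℝ⁺; ℂ)`. -/
abbrev L2 : Type := Lp ℂ 2 halfLine

/-- Pairs in `L²(ℝ⁺) × L²(ℝ⁺)` with the Hilbert norm `‖(u, v)‖² = ‖u‖² + ‖v‖²`. -/
abbrev L2Pair : Type := WithLp 2 (L2 × L2)

theorem IsTest.zero : IsTest 0 where
  smooth := contDiff_const
  compact := HasCompactSupport.zero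
  support := by simp [tsupport]

theorem IsTest.add {φ ψ : ℝ → ℂ} (hφ : IsTest φ) (hψ : IsTest ψ) : IsTest (φ + ψ) where
  smooth := hφ.smooth.add hψ.smooth
  compact := hφ.compact.add hψ.compact
  support := (tsupport_add φ ψ).trans (union_subset hφ.support hψ.support)

theorem IsTest.smul {φ : ℝ → ℂ} (a : ℂ) (hφ : IsTest φ) : IsTest (a • φ) where
  smooth := contDiff_const.smul hφ.smooth
  compact := hφ.compact.smul_left (f := fun _ => a)
  support := (closure_mono (Function.support_const_smul_subset a φ)).trans hφ.support

theorem IsTest.memLp {φ : ℝ → ℂ} (hφ : IsTest φ) : MemLp φ 2 halfLine :=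
  (hφ.smooth.continuous.memLp_of_hasCompactSupport hφ.compact)

theorem IsTest.memLp_deriv {φ : ℝ → ℂ} (hφ : IsTest φ) : MemLp (deriv φ) 2 halfLine :=
  ((hφ.smooth.continuous_deriv (by simp)).memLp_of_hasCompactSupport hφ.compact.deriv)

/-- The Sobolev space `H¹(ℝ⁺; ℂ)`: an element is the pair `(u, u')` of a function in `L²` and its
weak derivative in `L²`, with norm `(‖u‖² + ‖u'‖²)^{1/2}`. -/
noncomputable def H1 : Submodule ℂ L2Pair where
  carrier := {f | IsWeakDeriv f.fst f.snd}
  zero_mem' := by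
    intro φ hφ
    have h : ((0 : L2) : ℝ → ℂ) =ᵐ[halfLine] 0 := Lp.coeFn_zero ℂ 2 halfLine
    have e1 : ∫ x, ((0 : L2) : ℝ → ℂ) x * deriv φ x ∂halfLine = 0 :=
      integral_eq_zero_of_ae (by filter_upwards [h] with x hx; rw [hx]; simp)
    have e2 : ∫ x, ((0 : L2) : ℝ → ℂ) x * φ x ∂halfLine = 0 :=
      integral_eq_zero_of_ae (by filter_upwards [h] with x hx; rw [hx]; simp)
    change ∫ x, ((0 : L2) : ℝ → ℂ) x * deriv φ x ∂halfLine
      = - ∫ x, ((0 : L2) : ℝ → ℂ) x * φ x ∂halfLine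
    rw [e1, e2, neg_zero]
  add_mem' := by
    intro f g hf hg φ hφ
    have key : ∀ (a b : L2) (ψ : ℝ → ℂ), MemLp ψ 2 halfLine →
        ∫ x, ((a + b : L2) : ℝ → ℂ) x * ψ x ∂halfLine
          = ∫ x, a x * ψ x ∂halfLine + ∫ x, b x * ψ x ∂halfLine := by
      intro a b ψ hψ
      have ha : Integrable (fun x => a x * ψ x) halfLine := (Lp.memLp a).integrable_mul hψ
      have hb : Integrable (fun x => b x * ψ x) halfLine := (Lp.memLp b).integrable_mul hψ
      rw [← integral_add ha hb]
      refine integral_congr_ae ?_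
      filter_upwards [Lp.coeFn_add a b] with x hx
      rw [hx, Pi.add_apply, add_mul]
    change ∫ x, ((f.fst + g.fst : L2) : ℝ → ℂ) x * deriv φ x ∂halfLine
      = - ∫ x, ((f.snd + g.snd : L2) : ℝ → ℂ) x * φ x ∂halfLine
    rw [key _ _ _ hφ.memLp_deriv, key _ _ _ hφ.memLp, hf φ hφ, hg φ hφ]
    ring
  smul_mem' := by
    intro c f hf φ hφ
    have key : ∀ (a : L2) (ψ : ℝ → ℂ),
        ∫ x, ((c • a : L2) : ℝ → ℂ) x * ψ x ∂halfLine = c * ∫ x, a x * ψ x ∂halfLine := by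
      intro a ψ
      rw [← integral_const_mul]
      refine integral_congr_ae ?_
      filter_upwards [Lp.coeFn_smul c a] with x hx
      simp [hx, mul_assoc]
    change ∫ x, ((c • f.fst : L2) : ℝ → ℂ) x * deriv φ x ∂halfLine
      = - ∫ x, ((c • f.snd : L2) : ℝ → ℂ) x * φ x ∂halfLine
    rw [key, key, hf φ hφ]
    ring

/-- The pairs `(φ, φ')` with `φ ∈ C_c^∞((0, ∞); ℂ)`. -/
noncomputable def testPairs : Submodule ℂ L2Pair where
  carrier := {f | ∃ φ : ℝ → ℂ, IsTest φ ∧ f.fst =ᵐ[halfLine] φ ∧ f.snd =ᵐ[halfLine] deriv φ}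
  zero_mem' := by
    refine ⟨0, IsTest.zero, Lp.coeFn_zero ℂ 2 halfLine, ?_⟩
    have : deriv (0 : ℝ → ℂ) = 0 := by ext x; simp
    rw [this]
    exact Lp.coeFn_zero ℂ 2 halfLine
  add_mem' := by
    rintro f g ⟨φ, hφ, h1, h2⟩ ⟨ψ, hψ, h3, h4⟩
    refine ⟨φ + ψ, hφ.add hψ, ?_, ?_⟩
    · exact (Lp.coeFn_add f.fst g.fst).trans (h1.add h3)
    · have : deriv (φ + ψ) = deriv φ + deriv ψ := by
        ext x
        exact deriv_add (hφ.smooth.differentiable (by simp) x)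
          (hψ.smooth.differentiable (by simp) x)
      rw [this]
      exact (Lp.coeFn_add f.snd g.snd).trans (h2.add h4)
  smul_mem' := by
    rintro a f ⟨φ, hφ, h1, h2⟩
    refine ⟨a • φ, hφ.smul a, ?_, ?_⟩
    · exact (Lp.coeFn_smul a f.fst).trans (h1.const_smul a)
    · have : deriv (a • φ) = a • deriv φ := by
        ext x
        exact deriv_const_smul a (hφ.smooth.differentiable (by simp) x)
      rw [this]
      exact (Lp.coeFn_smul a f.snd).trans (h2.const_smul a)

/-- `H¹₀(ℝ⁺; ℂ)`: the closure of `C_c^∞((0, ∞); ℂ)` in `H¹(ℝ⁺; ℂ)`. -/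
noncomputable def H10Submodule : Submodule ℂ L2Pair := H1 ⊓ testPairs.topologicalClosure

/-- `H¹₀(ℝ⁺; ℂ)` as a normed space, with the `H¹` norm. -/
abbrev H10 : Type := H10Submodule

/-- The function `u` underlying an element of `H¹₀(ℝ⁺)`. -/
noncomputable def H10.fn (u : H10) : ℝ → ℂ := (u : L2Pair).fst

/-- The weak derivative `u'` of an element of `H¹₀(ℝ⁺)`. -/
noncomputable def H10.dfn (u : H10) : ℝ → ℂ := (u : L2Pair).snd

/-- The Hardy functional `H(u) = ∫ |u'|² - (c / x²) |u|²`. -/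
noncomputable def hardy (c : ℝ) (u : H10) : ℝ :=
  ∫ x, (‖u.dfn x‖ ^ 2 - c / x ^ 2 * ‖u.fn x‖ ^ 2) ∂halfLine

/-- The action
`S(u) = ½ ‖u'‖² - (c/2) ‖u/x‖² + (ω/2) ‖u‖² - 1/(p+1) ‖u‖_{p+1}^{p+1}`. -/
noncomputable def action (c ω p : ℝ) (u : H10) : ℝ :=
  1 / 2 * (∫ x, ‖u.dfn x‖ ^ 2 ∂halfLine) - c / 2 * (∫ x, ‖u.fn x‖ ^ 2 / x ^ 2 ∂halfLine)
    + ω / 2 * (∫ x, ‖u.fn x‖ ^ 2 ∂halfLine)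
    - 1 / (p + 1) * (∫ x, ‖u.fn x‖ ^ (p + 1) ∂halfLine)

/-- The Nehari functional `J(u) = ⟨S'(u), u⟩ = H(u) + ω ‖u‖² - ‖u‖_{p+1}^{p+1}`. -/
noncomputable def nehariFunctional (c ω p : ℝ) (u : H10) : ℝ :=
  hardy c u + ω * (∫ x, ‖u.fn x‖ ^ 2 ∂halfLine) - ∫ x, ‖u.fn x‖ ^ (p + 1) ∂halfLine

/-- The Nehari manifold `𝒩 = {u ∈ H¹₀(ℝ⁺) \ {0} : J(u) = 0}`. -/
def nehariManifold (c ω p : ℝ) : Set H10 := {u | u ≠ 0 ∧ nehariFunctional c ω p u = 0}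

/-- `m = inf {S(u) : u ∈ 𝒩}`. -/
noncomputable def nehariInf (c ω p : ℝ) : ℝ := sInf (action c ω p '' nehariManifold c ω p)

/-- The integrand of `-⟨φ'' + c φ / x² - ω φ + |φ|^{p-1} φ, v⟩`, after integration by parts. -/
noncomputable def weakIntegrand (c ω p : ℝ) (φ v : H10) (x : ℝ) : ℂ :=
  φ.dfn x * conj (v.dfn x) - ((c / x ^ 2 : ℝ) : ℂ) * φ.fn x * conj (v.fn x)
    + (ω : ℂ) * φ.fn x * conj (v.fn x)
    - ((‖φ.fn x‖ ^ (p - 1) : ℝ) : ℂ) * φ.fn x * conj (v.fn x)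

/-- `φ ∈ H¹₀(ℝ⁺)` solves `φ'' + c φ / x² - ω φ + |φ|^{p-1} φ = 0` in `H⁻¹(ℝ⁺)`, the dual
of `H¹₀(ℝ⁺)`. -/
def IsStationarySolution (c ω p : ℝ) (φ : H10) : Prop :=
  ∀ v : H10, Integrable (weakIntegrand c ω p φ v) halfLine ∧
    ∫ x, weakIntegrand c ω p φ v x ∂halfLine = 0

end HalfLineNLS

namespace HalfLineNLS

open Filter Topology

/-! ### Test functions -/

/-! Write E(u) = ‖u'‖² - c‖u/x‖² + ω‖u‖² (`energy`) and N(u) for the integral of |u|^(p+1)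
(`powerNorm`). Hardy's inequality with constant 4 and c < 1/4 make E coercive on H¹₀. On the Nehari
manifold E = N, so S = (1/2 - 1/(p+1)) E there, and minimizing S amounts to attaining the sharp
constant M (`bestConst`) in N ≤ M E^((p+1)/2). A function with E = 1 and N = M, multiplied by t with
t^(p-1) M = 1, is the minimizer. The equation is the vanishing first variation of M E^((p+1)/2) - N,
which is nonnegative and zero at that point.

Attaining M is a compactness problem, since a maximizing sequence could escape to infinity. M is
defined as a supremum over nonnegative test functions, and a smooth approximation of the modulus
shows that it serves all of H¹₀ (`powerNorm_le_bestConst`). Let u be a weak limit of a maximizing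
sequence and q = E(u). If u ≠ 0, a one-sided Brezis–Lieb estimate (`powerNorm_le_of_ae_tendsto`)
gives 1 ≤ (1 - q)^s + q^s with s = (p+1)/2 > 1, which forces q = 1. Everything therefore rests on u
≠ 0 (`not_tendsto_zero_of_maximizing`).

If u = 0, the sequence tends to 0 at every point, because point evaluation is a continuous
functional, and the potential is not felt in the limit. A calibration (`calibration_interval`)
bounds the potential-free energy of a bump from below by its height alone, without rearrangement. In
the limit it gives ω a^(1-p) M + 4√ω a² K ≤ 1, where a > 0 is a limit of the maxima and K = `calib p
1 1`. If M were only the quotient of the sech soliton on the full line, the left side would have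
minimum exactly 1 in a. But a soliton truncated and moved to distance L gains order L⁻² from the
potential and loses only an exponentially small amount, so M is strictly larger
(`soliton_lt_bestConst`) and the left side exceeds 1 for every a (`one_lt_of_bestConst`), a
contradiction. -/

theorem IsTest.eq_zero_of_nonpos {φ : ℝ → ℂ} (hφ : IsTest φ) {x : ℝ} (hx : x ≤ 0) : φ x = 0 :=
  image_eq_zero_of_notMem_tsupport fun h => not_lt.2 hx (hφ.support h)

theorem IsTest.deriv {φ : ℝ → ℂ} (hφ : IsTest φ) : IsTest (deriv φ) where
  smooth := ((contDiff_infty_iff_deriv (𝕜 := ℝ)).1 hφ.smooth).2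
  compact := hφ.compact.deriv
  support := tsupport_deriv_subset.trans hφ.support

theorem IsTest.continuous {φ : ℝ → ℂ} (hφ : IsTest φ) : Continuous φ := hφ.smooth.continuous

theorem IsTest.hasDerivAt {φ : ℝ → ℂ} (hφ : IsTest φ) (x : ℝ) :
    HasDerivAt φ (_root_.deriv φ x) x :=
  (hφ.smooth.differentiable (by simp) x).hasDerivAt

theorem integral_halfLine_eq {E : Type*} [NormedAddCommGroup E] [NormedSpace ℝ E] {g : ℝ → E}
    (hg : ∀ x ≤ 0, g x = 0) : ∫ x, g x ∂halfLine = ∫ x, g x :=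
  setIntegral_eq_integral_of_forall_compl_eq_zero fun x hx => hg x (not_lt.1 hx)

theorem IsTest.isWeakDeriv {φ : ℝ → ℂ} (hφ : IsTest φ) : IsWeakDeriv φ (_root_.deriv φ) := by
  intro ψ hψ
  rw [integral_halfLine_eq (fun x hx => by rw [hφ.eq_zero_of_nonpos hx, zero_mul]),
    integral_halfLine_eq (fun x hx => by rw [hψ.eq_zero_of_nonpos hx, mul_zero])]
  refine integral_mul_deriv_eq_deriv_mul_of_integrable (fun x _ => hφ.hasDerivAt x)
    (fun x _ => hψ.hasDerivAt x) ?_ ?_ ?_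
  · exact (hφ.continuous.mul hψ.deriv.continuous).integrable_of_hasCompactSupport
      hφ.compact.mul_right
  · exact (hφ.deriv.continuous.mul hψ.continuous).integrable_of_hasCompactSupport
      hψ.compact.mul_left
  · exact (hφ.continuous.mul hψ.continuous).integrable_of_hasCompactSupport
      hψ.compact.mul_left

theorem IsWeakDeriv.congr_ae {u v u' v' : ℝ → ℂ} (h : IsWeakDeriv u v)
    (hu : u' =ᵐ[halfLine] u) (hv : v' =ᵐ[halfLine] v) : IsWeakDeriv u' v' := by
  intro φ hφ
  have e1 : ∫ x, u' x * _root_.deriv φ x ∂halfLine = ∫ x, u x * _root_.deriv φ x ∂halfLine :=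
    integral_congr_ae (by filter_upwards [hu] with x hx; rw [hx])
  have e2 : ∫ x, v' x * φ x ∂halfLine = ∫ x, v x * φ x ∂halfLine :=
    integral_congr_ae (by filter_upwards [hv] with x hx; rw [hx])
  rw [e1, e2, h φ hφ]

/-- A test function as an element of `H¹₀(ℝ⁺)`. -/
noncomputable def IsTest.toH10 {φ : ℝ → ℂ} (hφ : IsTest φ) : H10 :=
  ⟨WithLp.toLp 2 (hφ.memLp.toLp φ, hφ.memLp_deriv.toLp (_root_.deriv φ)), by
    refine ⟨hφ.isWeakDeriv.congr_ae hφ.memLp.coeFn_toLp hφ.memLp_deriv.coeFn_toLp, ?_⟩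
    exact Submodule.le_topologicalClosure _
      ⟨φ, hφ, hφ.memLp.coeFn_toLp, hφ.memLp_deriv.coeFn_toLp⟩⟩

theorem IsTest.toH10_fn {φ : ℝ → ℂ} (hφ : IsTest φ) : hφ.toH10.fn =ᵐ[halfLine] φ :=
  hφ.memLp.coeFn_toLp

theorem IsTest.toH10_dfn {φ : ℝ → ℂ} (hφ : IsTest φ) :
    hφ.toH10.dfn =ᵐ[halfLine] _root_.deriv φ :=
  hφ.memLp_deriv.coeFn_toLp

theorem IsTest.eq_integral_deriv {φ : ℝ → ℂ} (hφ : IsTest φ) (x : ℝ) :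
    φ x = ∫ t in (0 : ℝ)..x, _root_.deriv φ t := by
  rw [intervalIntegral.integral_eq_sub_of_hasDerivAt (fun t _ => hφ.hasDerivAt t)
    (hφ.deriv.continuous.intervalIntegrable _ _), hφ.eq_zero_of_nonpos le_rfl, sub_zero]

theorem IsTest.exists_support_subset {φ : ℝ → ℂ} (hφ : IsTest φ) :
    ∃ R : ℝ, 0 < R ∧ ∀ x, R < x → φ x = 0 := by
  obtain ⟨R, hR⟩ := hφ.compact.isCompact.isBounded.subset_closedBall 0
  refine ⟨max R 1, by positivity, fun x hx => image_eq_zero_of_notMem_tsupport fun h => ?_⟩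
  have h1 := hR h
  rw [mem_closedBall_zero_iff, Real.norm_eq_abs] at h1
  exact absurd ((le_abs_self x).trans h1) (not_le.2 ((le_max_left _ _).trans_lt hx))

/-- The closed support avoids 0, so the singular factor only meets a neighbourhood on which φ
vanishes. -/
theorem IsTest.div_id {φ : ℝ → ℂ} (hφ : IsTest φ) : IsTest (fun x => ((x⁻¹ : ℝ) : ℂ) * φ x) where
  smooth := by
    rw [contDiff_iff_contDiffAt]
    intro x
    by_cases hx : x = 0
    · have h0 : (0 : ℝ) ∉ tsupport φ := fun h => lt_irrefl (0 : ℝ) (hφ.support h)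
      have : (fun x : ℝ => ((x⁻¹ : ℝ) : ℂ) * φ x) =ᶠ[𝓝 x] fun _ => 0 := by
        rw [hx]
        filter_upwards [(isClosed_tsupport φ).isOpen_compl.mem_nhds h0] with y hy
        rw [image_eq_zero_of_notMem_tsupport hy, mul_zero]
      exact contDiffAt_const.congr_of_eventuallyEq this
    · exact (Complex.ofRealCLM.contDiff.contDiffAt.comp x (contDiffAt_inv ℝ hx)).mul
        hφ.smooth.contDiffAt
  compact := hφ.compact.mul_left
  support := (closure_mono (Function.support_mul_subset_right _ _)).trans hφ.support

/-! ### Hardy's inequality and the sup bound for test functions. -/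

theorem norm_inv_mul_sq (x : ℝ) (z : ℂ) : ‖((x⁻¹ : ℝ) : ℂ) * z‖ ^ 2 = ‖z‖ ^ 2 / x ^ 2 := by
  rw [norm_mul, Complex.norm_real, Real.norm_eq_abs, mul_pow, sq_abs, inv_pow, div_eq_inv_mul]

theorem IsTest.integrable_norm_sq {φ : ℝ → ℂ} (hφ : IsTest φ) :
    Integrable (fun x => ‖φ x‖ ^ 2) := by
  have h : HasCompactSupport ((fun z : ℂ => ‖z‖ ^ 2) ∘ φ) := hφ.compact.comp_left (by simp)
  have hc : Continuous ((fun z : ℂ => ‖z‖ ^ 2) ∘ φ) := hφ.continuous.norm.pow 2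
  exact hc.integrable_of_hasCompactSupport h

theorem IsTest.integrable_norm_sq_div {φ : ℝ → ℂ} (hφ : IsTest φ) :
    Integrable (fun x => ‖φ x‖ ^ 2 / x ^ 2) := by
  simpa only [norm_inv_mul_sq] using hφ.div_id.integrable_norm_sq

/-- Hardy's inequality on `(0, d)`, without boundary condition at `d`. -/
theorem IsTest.hardy_interval {φ : ℝ → ℂ} (hφ : IsTest φ) {d : ℝ} (hd : 0 ≤ d) :
    ∫ x in (0 : ℝ)..d, ‖φ x‖ ^ 2 / x ^ 2 ≤ 4 * ∫ x in (0 : ℝ)..d, ‖_root_.deriv φ x‖ ^ 2 := by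
  set ψ : ℝ → ℂ := fun x => ((x⁻¹ : ℝ) : ℂ) * φ x with hψdef
  have hψ : IsTest ψ := hφ.div_id
  have hφψ : φ = fun x : ℝ => (x : ℂ) * ψ x := by
    ext x
    by_cases hx : x = 0
    · simp [hx, hφ.eq_zero_of_nonpos le_rfl]
    · simp [hψdef, hx]
  have hder : ∀ x, _root_.deriv φ x = ψ x + x * _root_.deriv ψ x := by
    intro x
    have h1 : HasDerivAt (fun x : ℝ => (x : ℂ)) 1 x := Complex.ofRealCLM.hasDerivAt
    have h := h1.mul (hψ.hasDerivAt x)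
    have e : (fun x : ℝ => (x : ℂ)) * ψ = φ := hφψ.symm
    rw [e] at h
    rw [h.deriv, one_mul]
  have hG : ∀ x, HasDerivAt (fun x : ℝ => x * ‖ψ x‖ ^ 2)
      (‖ψ x‖ ^ 2 + x * (2 * inner ℝ (ψ x) (_root_.deriv ψ x))) x := by
    intro x
    exact ((hasDerivAt_id x).fun_mul (hψ.hasDerivAt x).norm_sq).congr_deriv (by simp)
  have c0 := hψ.continuous
  have c1 := hψ.deriv.continuous
  have hint : ∫ x in (0 : ℝ)..d, (‖ψ x‖ ^ 2 + x * (2 * inner ℝ (ψ x) (_root_.deriv ψ x)))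
      = d * ‖ψ d‖ ^ 2 := by
    rw [intervalIntegral.integral_eq_sub_of_hasDerivAt (fun x _ => hG x)
      (Continuous.intervalIntegrable (by fun_prop) _ _)]
    simp
  -- With φ = xψ the difference of the two sides is |ψ + 2xψ'|². The derivative of x|ψ|² on the left
  -- integrates to d|ψ(d)|² ≥ 0, which is why no condition at d is needed.
  have key : ∀ x, ‖ψ x‖ ^ 2 + 2 * (‖ψ x‖ ^ 2 + x * (2 * inner ℝ (ψ x) (_root_.deriv ψ x)))
      ≤ 4 * ‖_root_.deriv φ x‖ ^ 2 := by
    intro x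
    have e1 : ‖_root_.deriv φ x‖ ^ 2 = ‖ψ x‖ ^ 2 + 2 * (x * inner ℝ (ψ x) (_root_.deriv ψ x))
        + x ^ 2 * ‖_root_.deriv ψ x‖ ^ 2 := by
      have e0 : (x : ℂ) * _root_.deriv ψ x = x • _root_.deriv ψ x := by simp
      rw [hder, e0, norm_add_sq_real, inner_smul_right, norm_smul, mul_pow, Real.norm_eq_abs,
        sq_abs]
    have e2 : -(‖ψ x‖ * (|x| * ‖_root_.deriv ψ x‖)) ≤ x * inner ℝ (ψ x) (_root_.deriv ψ x) := by
      have := abs_real_inner_le_norm (ψ x) (_root_.deriv ψ x)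
      have h2 : |x * inner ℝ (ψ x) (_root_.deriv ψ x)| ≤ ‖ψ x‖ * (|x| * ‖_root_.deriv ψ x‖) := by
        rw [abs_mul]
        calc |x| * |inner ℝ (ψ x) (_root_.deriv ψ x)|
            ≤ |x| * (‖ψ x‖ * ‖_root_.deriv ψ x‖) := by gcongr
          _ = _ := by ring
      exact (abs_le.1 h2).1
    have e3 : x ^ 2 * ‖_root_.deriv ψ x‖ ^ 2 = (|x| * ‖_root_.deriv ψ x‖) ^ 2 := by
      rw [mul_pow, sq_abs]
    rw [e1, e3]
    nlinarith [sq_nonneg (‖ψ x‖ - 2 * (|x| * ‖_root_.deriv ψ x‖))]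
  have hmono := intervalIntegral.integral_mono_on (μ := volume) hd
    (Continuous.intervalIntegrable (by fun_prop) _ _)
    (Continuous.intervalIntegrable (by have := hφ.deriv.continuous; fun_prop) _ _)
    (fun x _ => key x)
  rw [intervalIntegral.integral_add (Continuous.intervalIntegrable (by fun_prop) _ _)
    (Continuous.intervalIntegrable (by fun_prop) _ _), intervalIntegral.integral_const_mul,
    intervalIntegral.integral_const_mul, hint] at hmono
  have e4 : ∫ x in (0 : ℝ)..d, ‖φ x‖ ^ 2 / x ^ 2 = ∫ x in (0 : ℝ)..d, ‖ψ x‖ ^ 2 := by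
    simp only [hψdef, norm_inv_mul_sq]
  rw [e4]
  have : 0 ≤ d * ‖ψ d‖ ^ 2 := by positivity
  linarith

theorem integral_Ioi_zero_eq_interval {g : ℝ → ℝ} {R : ℝ} (hR : 0 ≤ R)
    (hg : ∀ x, R < x → g x = 0) : ∫ x, g x ∂halfLine = ∫ x in (0 : ℝ)..R, g x := by
  rw [intervalIntegral.integral_of_le hR]
  refine (setIntegral_eq_of_subset_of_forall_sdiff_eq_zero measurableSet_Ioi
    Ioc_subset_Ioi_self ?_)
  intro x hx
  refine hg x (not_le.1 fun h => hx.2 ⟨hx.1, h⟩)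

theorem IsTest.hardy {φ : ℝ → ℂ} (hφ : IsTest φ) :
    ∫ x, ‖φ x‖ ^ 2 / x ^ 2 ∂halfLine ≤ 4 * ∫ x, ‖_root_.deriv φ x‖ ^ 2 ∂halfLine := by
  obtain ⟨R, hR, h⟩ := hφ.exists_support_subset
  obtain ⟨R', hR', h'⟩ := hφ.deriv.exists_support_subset
  have hm : (0 : ℝ) ≤ max R R' := hR.le.trans (le_max_left _ _)
  rw [integral_Ioi_zero_eq_interval hm, integral_Ioi_zero_eq_interval hm]
  · exact hφ.hardy_interval hm
  · intro x hx; simp [h' x ((le_max_right _ _).trans_lt hx)]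
  · intro x hx; simp [h x ((le_max_left _ _).trans_lt hx)]

theorem IsTest.norm_sq_le {φ : ℝ → ℂ} (hφ : IsTest φ) (x : ℝ) :
    ‖φ x‖ ^ 2 ≤ ∫ x, ‖φ x‖ ^ 2 ∂halfLine + ∫ x, ‖_root_.deriv φ x‖ ^ 2 ∂halfLine := by
  have i1 := hφ.integrable_norm_sq.restrict (s := Ioi 0)
  have i2 := hφ.deriv.integrable_norm_sq.restrict (s := Ioi 0)
  rw [← integral_add i1 i2]
  rcases le_total x 0 with hx | hx
  · rw [hφ.eq_zero_of_nonpos hx, norm_zero, zero_pow two_ne_zero]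
    exact integral_nonneg fun _ => by positivity
  have c0 := hφ.continuous
  have c1 := hφ.deriv.continuous
  have h1 : ‖φ x‖ ^ 2 = ∫ t in (0 : ℝ)..x, 2 * inner ℝ (φ t) (_root_.deriv φ t) := by
    rw [intervalIntegral.integral_eq_sub_of_hasDerivAt (fun t _ => (hφ.hasDerivAt t).norm_sq)
      (Continuous.intervalIntegrable (by fun_prop) _ _), hφ.eq_zero_of_nonpos le_rfl]
    simp
  rw [h1]
  calc ∫ t in (0 : ℝ)..x, 2 * inner ℝ (φ t) (_root_.deriv φ t)
      ≤ ∫ t in (0 : ℝ)..x, (‖φ t‖ ^ 2 + ‖_root_.deriv φ t‖ ^ 2) := by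
        refine intervalIntegral.integral_mono_on hx
          (Continuous.intervalIntegrable (by fun_prop) _ _)
          (Continuous.intervalIntegrable (by fun_prop) _ _) fun t _ => ?_
        nlinarith [real_inner_le_norm (φ t) (_root_.deriv φ t),
          sq_nonneg (‖φ t‖ - ‖_root_.deriv φ t‖)]
    _ ≤ _ := by
        rw [intervalIntegral.integral_of_le hx]
        exact setIntegral_mono_set (i1.add i2) (ae_of_all _ fun t => by simp; positivity)
          (LE.le.eventuallyLE Ioc_subset_Ioi_self)

/-! ### The space `H¹₀` -/

theorem L2_norm_sq (f : L2) : ‖f‖ ^ 2 = ∫ x, ‖f x‖ ^ 2 ∂halfLine := by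
  have h := L2.inner_def (𝕜 := ℂ) f f
  rw [inner_self_eq_norm_sq_to_K] at h
  have : ((‖f‖ ^ 2 : ℝ) : ℂ) = ((∫ x, ‖f x‖ ^ 2 ∂halfLine : ℝ) : ℂ) := by
    rw [← integral_complex_ofReal]
    push_cast
    refine h.trans (integral_congr_ae (ae_of_all _ fun x => ?_))
    simp [inner_self_eq_norm_sq_to_K]
  exact_mod_cast this

/-- The embedding `H¹₀ → L²`. -/
noncomputable def fstL : H10 →L[ℂ] L2 := (WithLp.fstL 2 ℂ L2 L2).comp H10Submodule.subtypeL

/-- The weak derivative as a map `H¹₀ → L²`. -/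
noncomputable def sndL : H10 →L[ℂ] L2 := (WithLp.sndL 2 ℂ L2 L2).comp H10Submodule.subtypeL

theorem fstL_coe (u : H10) : (fstL u : ℝ → ℂ) = u.fn := rfl

theorem sndL_coe (u : H10) : (sndL u : ℝ → ℂ) = u.dfn := rfl

theorem H10.norm_sq_eq (u : H10) : ‖u‖ ^ 2 = ‖fstL u‖ ^ 2 + ‖sndL u‖ ^ 2 :=
  WithLp.prod_norm_sq_eq_of_L2 (u : L2Pair)

theorem norm_fstL_sq (u : H10) : ‖fstL u‖ ^ 2 = ∫ x, ‖u.fn x‖ ^ 2 ∂halfLine := L2_norm_sq _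

theorem norm_sndL_sq (u : H10) : ‖sndL u‖ ^ 2 = ∫ x, ‖u.dfn x‖ ^ 2 ∂halfLine := L2_norm_sq _

theorem H10.memLp_fn (u : H10) : MemLp u.fn 2 halfLine := Lp.memLp (fstL u)

theorem H10.memLp_dfn (u : H10) : MemLp u.dfn 2 halfLine := Lp.memLp (sndL u)

theorem H10.fn_add (u v : H10) : (u + v).fn =ᵐ[halfLine] u.fn + v.fn :=
  Lp.coeFn_add (fstL u) (fstL v)

theorem H10.fn_sub (u v : H10) : (u - v).fn =ᵐ[halfLine] u.fn - v.fn :=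
  Lp.coeFn_sub (fstL u) (fstL v)

theorem H10.fn_smul (a : ℂ) (u : H10) : (a • u).fn =ᵐ[halfLine] a • u.fn :=
  Lp.coeFn_smul a (fstL u)

theorem IsTest.norm_toH10_sq {φ : ℝ → ℂ} (hφ : IsTest φ) :
    ‖hφ.toH10‖ ^ 2
      = ∫ x, ‖φ x‖ ^ 2 ∂halfLine + ∫ x, ‖_root_.deriv φ x‖ ^ 2 ∂halfLine := by
  rw [H10.norm_sq_eq, norm_fstL_sq, norm_sndL_sq]
  congr 1 <;> refine integral_congr_ae ?_
  · filter_upwards [hφ.toH10_fn] with x hx; rw [hx]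
  · filter_upwards [hφ.toH10_dfn] with x hx; rw [hx]

/-- Norm convergence with almost everywhere convergence along a subsequence is what lets
inequalities for test functions pass to H¹₀ by Fatou's lemma. -/
theorem exists_test_seq (u : H10) : ∃ (φ : ℕ → ℝ → ℂ) (h : ∀ n, IsTest (φ n)),
    Tendsto (fun n => (h n).toH10) atTop (𝓝 u) ∧
    ∀ᵐ x ∂halfLine, Tendsto (fun n => φ n x) atTop (𝓝 (u.fn x)) := by
  have hu : (u : L2Pair) ∈ closure (testPairs : Set L2Pair) := u.2.2
  obtain ⟨f, hf, hfu⟩ := mem_closure_iff_seq_limit.1 hu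
  choose φ hφ h1 h2 using hf
  have heq : ∀ n, ((hφ n).toH10 : L2Pair) = f n := by
    intro n
    refine (WithLp.equiv 2 _).injective (Prod.ext ?_ ?_)
    · exact Lp.ext ((hφ n).toH10_fn.trans (h1 n).symm)
    · exact Lp.ext ((hφ n).toH10_dfn.trans (h2 n).symm)
  have hlim : Tendsto (fun n => (hφ n).toH10) atTop (𝓝 u) := by
    rw [tendsto_subtype_rng]
    simpa only [heq] using hfu
  have h3 : Tendsto (fun n => fstL (hφ n).toH10) atTop (𝓝 (fstL u)) :=
    (fstL.continuous.tendsto u).comp hlim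
  obtain ⟨ns, hns, hae⟩ := (tendstoInMeasure_of_tendsto_Lp h3).exists_seq_tendsto_ae
  refine ⟨fun n => φ (ns n), fun n => hφ (ns n), hlim.comp hns.tendsto_atTop, ?_⟩
  have h4 : ∀ᵐ x ∂halfLine, ∀ n, (hφ n).toH10.fn x = φ n x :=
    ae_all_iff.2 fun n => (hφ n).toH10_fn
  filter_upwards [hae, h4] with x hx hx'
  simpa only [fstL_coe, hx'] using hx

/-- H¹ is cut out of the pair space by equalities between continuous functionals. The resulting
completeness is needed for the Riesz representation behind weak compactness. -/
theorem isClosed_H10Submodule : IsClosed (H10Submodule : Set L2Pair) := by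
  have h1 : IsClosed (H1 : Set L2Pair) := by
    have hpair : ∀ ψ : ℝ → ℂ, MemLp ψ 2 halfLine →
        Continuous fun f : L2 => ∫ x, f x * ψ x ∂halfLine := by
      intro ψ hψ
      have hc : MemLp (fun x => conj (ψ x)) 2 halfLine := hψ.star
      have : (fun f : L2 => ∫ x, f x * ψ x ∂halfLine)
          = fun f => inner ℂ (hc.toLp _) f := by
        ext f
        rw [L2.inner_def]
        refine integral_congr_ae ?_
        filter_upwards [hc.coeFn_toLp] with x hx
        rw [hx]; simp
      rw [this]
      fun_prop
    have : (H1 : Set L2Pair) = ⋂ (φ : ℝ → ℂ) (_ : IsTest φ),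
        {f : L2Pair | ∫ x, f.fst x * deriv φ x ∂halfLine
          = - ∫ x, f.snd x * φ x ∂halfLine} := by
      ext f
      simp only [mem_iInter]
      rfl
    rw [this]
    refine isClosed_iInter fun φ => isClosed_iInter fun hφ => isClosed_eq ?_ ?_
    · exact (hpair _ hφ.memLp_deriv).comp (WithLp.fstL 2 ℂ L2 L2).continuous
    · exact ((hpair _ hφ.memLp).comp (WithLp.sndL 2 ℂ L2 L2).continuous).neg
  exact h1.inter (Submodule.isClosed_topologicalClosure _)

instance : CompleteSpace H10 := isClosed_H10Submodule.completeSpace_coe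

/-! ### Fatou's lemma for real integrals -/

theorem integrable_and_integral_le_of_tendsto {α : Type*} [MeasurableSpace α] {μ : Measure α}
    {F : ℕ → α → ℝ} {G : α → ℝ} {C : ℕ → ℝ} {C₀ : ℝ} (hF : ∀ n, Integrable (F n) μ)
    (hF0 : ∀ n, ∀ᵐ x ∂μ, 0 ≤ F n x) (hC : ∀ n, ∫ x, F n x ∂μ ≤ C n)
    (hC0 : Tendsto C atTop (𝓝 C₀))
    (hlim : ∀ᵐ x ∂μ, Tendsto (fun n => F n x) atTop (𝓝 (G x))) :
    Integrable G μ ∧ ∫ x, G x ∂μ ≤ C₀ := by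
  have hGm : AEStronglyMeasurable G μ :=
    aestronglyMeasurable_of_tendsto_ae atTop (fun n => (hF n).aestronglyMeasurable) hlim
  have hG0 : ∀ᵐ x ∂μ, 0 ≤ G x := by
    filter_upwards [hlim, ae_all_iff.2 hF0] with x hx hx0
    exact ge_of_tendsto' hx hx0
  have hle : ∫⁻ x, ENNReal.ofReal (G x) ∂μ ≤ ENNReal.ofReal C₀ := by
    calc ∫⁻ x, ENNReal.ofReal (G x) ∂μ
        = ∫⁻ x, liminf (fun n => ENNReal.ofReal (F n x)) atTop ∂μ := by
          refine lintegral_congr_ae ?_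
          filter_upwards [hlim] with x hx
          exact ((ENNReal.continuous_ofReal.tendsto _).comp hx).liminf_eq.symm
      _ ≤ liminf (fun n => ∫⁻ x, ENNReal.ofReal (F n x) ∂μ) atTop :=
          lintegral_liminf_le' fun n => (hF n).aestronglyMeasurable.aemeasurable.ennreal_ofReal
      _ ≤ liminf (fun n => ENNReal.ofReal (C n)) atTop := by
          refine liminf_le_liminf (Eventually.of_forall fun n => ?_)
          rw [← ofReal_integral_eq_lintegral_ofReal (hF n) (hF0 n)]
          exact ENNReal.ofReal_le_ofReal (hC n)
      _ = ENNReal.ofReal C₀ := ((ENNReal.continuous_ofReal.tendsto _).comp hC0).liminf_eq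
  have hC00 : 0 ≤ C₀ := ge_of_tendsto' hC0 fun n => (integral_nonneg_of_ae (hF0 n)).trans (hC n)
  have hi : Integrable G μ :=
    ⟨hGm, (hasFiniteIntegral_iff_ofReal hG0).2 (hle.trans_lt ENNReal.ofReal_lt_top)⟩
  refine ⟨hi, ?_⟩
  rw [← ofReal_integral_eq_lintegral_ofReal hi hG0] at hle
  exact (ENNReal.ofReal_le_ofReal_iff hC00).1 hle

/-! ### Hardy's inequality in `H¹₀` -/

theorem H10.hardy_inequality (u : H10) : Integrable (fun x => ‖u.fn x‖ ^ 2 / x ^ 2) halfLine ∧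
    ∫ x, ‖u.fn x‖ ^ 2 / x ^ 2 ∂halfLine ≤ 4 * ‖sndL u‖ ^ 2 := by
  obtain ⟨φ, hφ, hlim, hae⟩ := exists_test_seq u
  refine integrable_and_integral_le_of_tendsto (F := fun n x => ‖φ n x‖ ^ 2 / x ^ 2)
    (C := fun n => 4 * ‖sndL (hφ n).toH10‖ ^ 2) (fun n => (hφ n).integrable_norm_sq_div.restrict)
    (fun n => ae_of_all _ fun x => by positivity) (fun n => ?_) ?_ ?_
  · refine (hφ n).hardy.trans_eq ?_
    rw [norm_sndL_sq]
    congr 1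
    refine integral_congr_ae ?_
    filter_upwards [(hφ n).toH10_dfn] with x hx; rw [hx]
  · have h : Continuous fun v : H10 => 4 * ‖sndL v‖ ^ 2 := by fun_prop
    exact (h.tendsto u).comp hlim
  · filter_upwards [hae] with x hx
    exact (hx.norm.pow 2).div_const _

theorem H10.memLp_fn_div (u : H10) :
    MemLp (fun x : ℝ => ((x⁻¹ : ℝ) : ℂ) * u.fn x) 2 halfLine := by
  have hm : AEStronglyMeasurable (fun x : ℝ => ((x⁻¹ : ℝ) : ℂ) * u.fn x) halfLine :=
    (Complex.measurable_ofReal.comp measurable_inv).aestronglyMeasurable.mul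
      u.memLp_fn.aestronglyMeasurable
  rw [memLp_two_iff_integrable_sq_norm hm]
  simpa only [norm_inv_mul_sq] using u.hardy_inequality.1

/-- The map `u ↦ u / x` from `H¹₀` to `L²`. -/
noncomputable def hardyL : H10 →L[ℂ] L2 :=
  LinearMap.mkContinuous
    { toFun := fun u => u.memLp_fn_div.toLp _
      map_add' := by
        intro u v
        refine Lp.ext ?_
        filter_upwards [(u + v).memLp_fn_div.coeFn_toLp, u.memLp_fn_div.coeFn_toLp,
          v.memLp_fn_div.coeFn_toLp, Lp.coeFn_add (u.memLp_fn_div.toLp _) (v.memLp_fn_div.toLp _),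
          H10.fn_add u v] with x h1 h2 h3 h4 h5
        rw [h1, h4, Pi.add_apply, h2, h3, h5, Pi.add_apply, mul_add]
      map_smul' := by
        intro a u
        refine Lp.ext ?_
        filter_upwards [(a • u).memLp_fn_div.coeFn_toLp, u.memLp_fn_div.coeFn_toLp,
          Lp.coeFn_smul a (u.memLp_fn_div.toLp _), H10.fn_smul a u] with x h1 h2 h3 h4
        rw [h1, RingHom.id_apply, h3, Pi.smul_apply, h2, h4, Pi.smul_apply, smul_eq_mul,
          smul_eq_mul]
        ring } 2 (by
    intro u
    have h1 : ‖u.memLp_fn_div.toLp _‖ ^ 2 = ∫ x, ‖u.fn x‖ ^ 2 / x ^ 2 ∂halfLine := by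
      rw [L2_norm_sq]
      refine integral_congr_ae ?_
      filter_upwards [u.memLp_fn_div.coeFn_toLp] with x hx
      rw [hx, norm_inv_mul_sq]
    have h2 := u.hardy_inequality.2
    rw [← h1] at h2
    have h3 := H10.norm_sq_eq u
    refine abs_le_of_sq_le_sq' (a := _) ?_ (by positivity) |>.2
    change ‖u.memLp_fn_div.toLp _‖ ^ 2 ≤ (2 * ‖u‖) ^ 2
    nlinarith [sq_nonneg ‖fstL u‖])

theorem hardyL_coe (u : H10) :
    (hardyL u : ℝ → ℂ) =ᵐ[halfLine] fun x : ℝ => ((x⁻¹ : ℝ) : ℂ) * u.fn x :=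
  u.memLp_fn_div.coeFn_toLp

theorem norm_hardyL_sq (u : H10) : ‖hardyL u‖ ^ 2 = ∫ x, ‖u.fn x‖ ^ 2 / x ^ 2 ∂halfLine := by
  rw [L2_norm_sq]
  refine integral_congr_ae ?_
  filter_upwards [hardyL_coe u] with x hx
  rw [hx, norm_inv_mul_sq]

theorem norm_hardyL_sq_le (u : H10) : ‖hardyL u‖ ^ 2 ≤ 4 * ‖sndL u‖ ^ 2 :=
  (norm_hardyL_sq u).trans_le u.hardy_inequality.2

/-! ### Point evaluation -/

theorem halfLine_Ioc_ne_top (x : ℝ) : halfLine (Ioc 0 x) ≠ ⊤ :=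
  ((Measure.restrict_apply_le _ _).trans_lt (by simp)).ne

/-- The evaluation of `u` at `x`, as the integral of the weak derivative over `(0, x)`. -/
noncomputable def evalL (x : ℝ) : H10 →L[ℂ] ℂ :=
  (innerSL ℂ (indicatorConstLp 2 (measurableSet_Ioc (a := (0 : ℝ)) (b := x))
    (halfLine_Ioc_ne_top x) (1 : ℂ))).comp sndL

theorem evalL_apply {x : ℝ} (hx : 0 ≤ x) (u : H10) : evalL x u = ∫ t in (0 : ℝ)..x, u.dfn t := by
  have h := L2.inner_indicatorConstLp_one (𝕜 := ℂ) (measurableSet_Ioc (a := (0 : ℝ)) (b := x))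
    (halfLine_Ioc_ne_top x) (sndL u)
  rw [intervalIntegral.integral_of_le hx]
  refine Eq.trans h ?_
  rw [Measure.restrict_restrict measurableSet_Ioc, inter_eq_left.2 Ioc_subset_Ioi_self]
  rfl

/-- Cauchy–Schwarz on (0, x). It makes bounded families uniformly small near 0, which later keeps
the maximum points away from the origin. -/
theorem norm_evalL_le {x : ℝ} (hx : 0 ≤ x) (u : H10) : ‖evalL x u‖ ≤ √x * ‖sndL u‖ := by
  refine (norm_inner_le_norm (𝕜 := ℂ) (indicatorConstLp 2 (measurableSet_Ioc (a := (0 : ℝ))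
    (b := x)) (halfLine_Ioc_ne_top x) (1 : ℂ)) (sndL u)).trans ?_
  gcongr
  rw [norm_indicatorConstLp two_ne_zero ENNReal.ofNat_ne_top, norm_one, one_mul,
    Measure.real, Measure.restrict_apply measurableSet_Ioc, inter_eq_left.2 Ioc_subset_Ioi_self,
    Real.volume_Ioc, sub_zero, ENNReal.toReal_ofReal hx, Real.sqrt_eq_rpow]
  simp

theorem IsTest.evalL_eq {φ : ℝ → ℂ} (hφ : IsTest φ) {x : ℝ} (hx : 0 ≤ x) :
    evalL x hφ.toH10 = φ x := by
  rw [evalL_apply hx, hφ.eq_integral_deriv, intervalIntegral.integral_of_le hx,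
    intervalIntegral.integral_of_le hx]
  refine integral_congr_ae (ae_restrict_of_ae_restrict_of_subset Ioc_subset_Ioi_self hφ.toH10_dfn)

theorem ae_halfLine_pos : ∀ᵐ x ∂halfLine, 0 < x := ae_restrict_mem measurableSet_Ioi

/-- Since evaluation is a continuous functional, weak convergence yields pointwise convergence, and
no compact embedding is required. -/
theorem H10.fn_eq_evalL (u : H10) : ∀ᵐ x ∂halfLine, u.fn x = evalL x u := by
  obtain ⟨φ, hφ, hlim, hae⟩ := exists_test_seq u
  filter_upwards [hae, ae_halfLine_pos] with x hx hx0
  refine tendsto_nhds_unique hx ?_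
  have h := ((evalL x).continuous.tendsto u).comp hlim
  refine h.congr fun n => ?_
  exact (hφ n).evalL_eq hx0.le

theorem IsTest.norm_le {φ : ℝ → ℂ} (hφ : IsTest φ) (x : ℝ) : ‖φ x‖ ≤ ‖hφ.toH10‖ := by
  have h := hφ.norm_sq_le x
  rw [← hφ.norm_toH10_sq] at h
  exact abs_le_of_sq_le_sq' h (by positivity) |>.2

theorem H10.norm_fn_le (u : H10) : ∀ᵐ x ∂halfLine, ‖u.fn x‖ ≤ ‖u‖ := by
  obtain ⟨φ, hφ, hlim, hae⟩ := exists_test_seq u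
  filter_upwards [hae] with x hx
  exact le_of_tendsto_of_tendsto' hx.norm hlim.norm fun n => (hφ n).norm_le x

/-! ### The `L^{p+1}` norm and the quadratic form -/

theorem rpow_add_one_le {p a t : ℝ} (hp : 1 < p) (ht : 0 ≤ t) (hta : t ≤ a) :
    t ^ (p + 1) ≤ a ^ (p - 1) * t ^ 2 := by
  rcases ht.eq_or_lt with rfl | ht0
  · rw [Real.zero_rpow (by linarith)]; simp
  have e : t ^ (p + 1) = t ^ (p - 1) * t ^ 2 := by
    rw [← Real.rpow_natCast, ← Real.rpow_add ht0]; congr 1; push_cast; ring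
  rw [e]
  have := Real.rpow_le_rpow ht hta (by linarith : 0 ≤ p - 1)
  gcongr

/-- `‖u‖_{p+1}^{p+1}`. -/
noncomputable def powerNorm (p : ℝ) (u : H10) : ℝ := ∫ x, ‖u.fn x‖ ^ (p + 1) ∂halfLine

theorem H10.integrable_norm_sq (u : H10) : Integrable (fun x => ‖u.fn x‖ ^ 2) halfLine :=
  u.memLp_fn.integrable_norm_pow two_ne_zero

theorem H10.integrable_dnorm_sq (u : H10) : Integrable (fun x => ‖u.dfn x‖ ^ 2) halfLine :=
  u.memLp_dfn.integrable_norm_pow two_ne_zero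

theorem H10.integrable_power {p : ℝ} (hp : 1 < p) (u : H10) :
    Integrable (fun x => ‖u.fn x‖ ^ (p + 1)) halfLine := by
  refine (u.integrable_norm_sq.const_mul (‖u‖ ^ (p - 1))).mono' ?_ ?_
  · exact ((Real.continuous_rpow_const (by linarith : 0 ≤ p + 1)).measurable.comp_aemeasurable
      u.memLp_fn.aestronglyMeasurable.norm.aemeasurable).aestronglyMeasurable
  · filter_upwards [u.norm_fn_le] with x hx
    rw [Real.norm_of_nonneg (by positivity)]
    exact rpow_add_one_le hp (norm_nonneg _) hx

theorem powerNorm_nonneg (p : ℝ) (u : H10) : 0 ≤ powerNorm p u :=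
  integral_nonneg fun _ => by positivity

theorem powerNorm_le {p : ℝ} (hp : 1 < p) (u : H10) : powerNorm p u ≤ ‖u‖ ^ (p + 1) := by
  calc powerNorm p u ≤ ∫ x, ‖u‖ ^ (p - 1) * ‖u.fn x‖ ^ 2 ∂halfLine := by
        refine integral_mono_ae (u.integrable_power hp) (u.integrable_norm_sq.const_mul _) ?_
        filter_upwards [u.norm_fn_le] with x hx
        exact rpow_add_one_le hp (norm_nonneg _) hx
    _ = ‖u‖ ^ (p - 1) * ‖fstL u‖ ^ 2 := by rw [integral_const_mul, norm_fstL_sq]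
    _ ≤ ‖u‖ ^ (p - 1) * ‖u‖ ^ 2 := by
        gcongr ?_ * ?_
        rw [H10.norm_sq_eq]; linarith [sq_nonneg ‖sndL u‖]
    _ = ‖u‖ ^ (p + 1) := by
        rcases (norm_nonneg u).eq_or_lt with h | h
        · rw [← h, Real.zero_rpow (by linarith : p + 1 ≠ 0)]; simp
        · rw [← Real.rpow_natCast, ← Real.rpow_add h]; congr 1; push_cast; ring

/-! ### The quadratic form: polarization, homogeneity and coercivity. -/

/-- Twice the quadratic part of the action. -/
noncomputable def energy (c ω : ℝ) (u : H10) : ℝ :=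
  ‖sndL u‖ ^ 2 - c * ‖hardyL u‖ ^ 2 + ω * ‖fstL u‖ ^ 2

/-- The sesquilinear form polarizing `energy`, as a functional of its linear argument. -/
noncomputable def energyForm (c ω : ℝ) (v : H10) : H10 →L[ℂ] ℂ :=
  (innerSL ℂ (sndL v)).comp sndL - (c : ℂ) • (innerSL ℂ (hardyL v)).comp hardyL
    + (ω : ℂ) • (innerSL ℂ (fstL v)).comp fstL

theorem energyForm_apply (c ω : ℝ) (v u : H10) : energyForm c ω v u
    = inner ℂ (sndL v) (sndL u) - c * inner ℂ (hardyL v) (hardyL u)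
      + ω * inner ℂ (fstL v) (fstL u) := rfl

theorem energy_add (c ω : ℝ) (u v : H10) :
    energy c ω (u + v) = energy c ω u + energy c ω v + 2 * (energyForm c ω v u).re := by
  have h : ∀ f g : L2, ‖f + g‖ ^ 2 = ‖f‖ ^ 2 + ‖g‖ ^ 2 + 2 * (inner ℂ g f).re := by
    intro f g
    have := norm_add_sq (𝕜 := ℂ) g f
    rw [add_comm f g, this]
    simp only [RCLike.re_to_complex]
    ring
  rw [energyForm_apply]
  simp only [energy, map_add, h, Complex.add_re, Complex.sub_re, Complex.re_ofReal_mul]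
  ring

theorem energy_smul (c ω : ℝ) (a : ℂ) (u : H10) :
    energy c ω (a • u) = ‖a‖ ^ 2 * energy c ω u := by
  simp only [energy, map_smul, norm_smul]
  ring

theorem continuous_energy (c ω : ℝ) : Continuous (energy c ω) := by
  unfold energy; fun_prop

/-- Hardy gives c‖u/x‖² ≤ 4c‖u'‖². This is where the threshold c = 1/4 comes from. -/
theorem le_energy {c ω : ℝ} (hc0 : 0 < c) (u : H10) :
    (1 - 4 * c) * ‖sndL u‖ ^ 2 + ω * ‖fstL u‖ ^ 2 ≤ energy c ω u := by
  have := norm_hardyL_sq_le u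
  unfold energy
  nlinarith

theorem norm_sq_le_energy {c ω : ℝ} (hc0 : 0 < c) (u : H10) :
    min (1 - 4 * c) ω * ‖u‖ ^ 2 ≤ energy c ω u := by
  refine le_trans ?_ (le_energy hc0 u)
  rw [H10.norm_sq_eq, mul_add, add_comm]
  gcongr
  · exact min_le_left _ _
  · exact min_le_right _ _

theorem energy_nonneg {c ω : ℝ} (hc0 : 0 < c) (hc : c < 1 / 4) (hω : 0 < ω) (u : H10) :
    0 ≤ energy c ω u := by
  refine le_trans ?_ (norm_sq_le_energy hc0 u)
  have : 0 ≤ min (1 - 4 * c) ω := le_min (by linarith) hω.le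
  positivity

theorem energy_pos {c ω : ℝ} (hc0 : 0 < c) (hc : c < 1 / 4) (hω : 0 < ω) {u : H10}
    (hu : u ≠ 0) : 0 < energy c ω u := by
  refine lt_of_lt_of_le ?_ (norm_sq_le_energy hc0 u)
  have : 0 < min (1 - 4 * c) ω := lt_min (by linarith) hω
  have := norm_pos_iff.2 hu
  positivity

theorem powerNorm_smul (p : ℝ) (a : ℂ) (u : H10) :
    powerNorm p (a • u) = ‖a‖ ^ (p + 1) * powerNorm p u := by
  unfold powerNorm
  rw [← integral_const_mul]
  refine integral_congr_ae ?_
  filter_upwards [H10.fn_smul a u] with x hx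
  rw [hx, Pi.smul_apply, norm_smul, Real.mul_rpow (norm_nonneg _) (norm_nonneg _)]

theorem IsTest.energy_eq {φ : ℝ → ℂ} (hφ : IsTest φ) (c ω : ℝ) : energy c ω hφ.toH10
    = ∫ x, ‖_root_.deriv φ x‖ ^ 2 ∂halfLine - c * ∫ x, ‖φ x‖ ^ 2 / x ^ 2 ∂halfLine
      + ω * ∫ x, ‖φ x‖ ^ 2 ∂halfLine := by
  rw [energy, norm_fstL_sq, norm_sndL_sq, norm_hardyL_sq]
  congr 1
  · congr 1
    · refine integral_congr_ae ?_
      filter_upwards [hφ.toH10_dfn] with x hx; rw [hx]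
    · congr 1
      refine integral_congr_ae ?_
      filter_upwards [hφ.toH10_fn] with x hx; rw [hx]
  · congr 1
    refine integral_congr_ae ?_
    filter_upwards [hφ.toH10_fn] with x hx; rw [hx]

theorem IsTest.powerNorm_eq {φ : ℝ → ℂ} (hφ : IsTest φ) (p : ℝ) :
    powerNorm p hφ.toH10 = ∫ x, ‖φ x‖ ^ (p + 1) ∂halfLine := by
  refine integral_congr_ae ?_
  filter_upwards [hφ.toH10_fn] with x hx; rw [hx]

/-! ### Smooth approximation of the modulus -/

theorem hasDerivAt_sqrt_norm_sq {φ : ℝ → ℂ} (hφ : IsTest φ) {ε : ℝ} (hε : 0 < ε) (x : ℝ) :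
    HasDerivAt (fun x => ((√(‖φ x‖ ^ 2 + ε ^ 2) - ε : ℝ) : ℂ))
      ((2 * inner ℝ (φ x) (deriv φ x) / (2 * √(‖φ x‖ ^ 2 + ε ^ 2)) : ℝ) : ℂ) x := by
  refine HasDerivAt.ofReal_comp ?_
  refine HasDerivAt.sub_const _ ?_
  exact ((hφ.hasDerivAt x).norm_sq.add_const _).sqrt (by positivity)

/-- Adding ε² under the root removes the singularity of the modulus at zeros of φ. Subtracting ε
restores vanishing wherever φ vanishes, so the support does not grow. -/
theorem IsTest.sqrt_norm_sq {φ : ℝ → ℂ} (hφ : IsTest φ) {ε : ℝ} (hε : 0 < ε) :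
    IsTest (fun x => ((√(‖φ x‖ ^ 2 + ε ^ 2) - ε : ℝ) : ℂ)) where
  smooth := by
    refine Complex.ofRealCLM.contDiff.comp ?_
    refine ContDiff.sub (ContDiff.sqrt ((hφ.smooth.norm_sq ℝ).add contDiff_const) ?_)
      contDiff_const
    intro x; positivity
  compact := hφ.compact.comp_left (g := fun z : ℂ => ((√(‖z‖ ^ 2 + ε ^ 2) - ε : ℝ) : ℂ))
    (by simp [Real.sqrt_sq hε.le])
  support := by
    refine (closure_mono ?_).trans hφ.support
    intro x hx h0
    refine hx ?_
    simp [h0, Real.sqrt_sq hε.le]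

theorem sqrt_sq_add_sub_nonneg {t ε : ℝ} : 0 ≤ √(t ^ 2 + ε ^ 2) - ε := by
  rw [sub_nonneg]
  exact Real.le_sqrt_of_sq_le (by nlinarith [sq_nonneg t])

theorem sqrt_sq_add_sub_le {t ε : ℝ} (ht : 0 ≤ t) (hε : 0 < ε) : √(t ^ 2 + ε ^ 2) - ε ≤ t := by
  rw [sub_le_iff_le_add, Real.sqrt_le_left (by positivity)]
  nlinarith

theorem norm_deriv_sqrt_norm_sq_le {φ : ℝ → ℂ} (hφ : IsTest φ) {ε : ℝ} (hε : 0 < ε) (x : ℝ) :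
    ‖deriv (fun x => ((√(‖φ x‖ ^ 2 + ε ^ 2) - ε : ℝ) : ℂ)) x‖ ≤ ‖deriv φ x‖ := by
  rw [(hasDerivAt_sqrt_norm_sq hφ hε x).deriv, Complex.norm_real, Real.norm_eq_abs,
    mul_div_mul_left _ _ two_ne_zero, abs_div]
  have h0 : 0 < √(‖φ x‖ ^ 2 + ε ^ 2) := Real.sqrt_pos.2 (by positivity)
  rw [abs_of_pos h0, div_le_iff₀ h0]
  have h1 : ‖φ x‖ ≤ √(‖φ x‖ ^ 2 + ε ^ 2) := Real.le_sqrt_of_sq_le (by nlinarith)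
  calc |inner ℝ (φ x) (deriv φ x)| ≤ ‖φ x‖ * ‖deriv φ x‖ := abs_real_inner_le_norm _ _
    _ ≤ √(‖φ x‖ ^ 2 + ε ^ 2) * ‖deriv φ x‖ := by gcongr
    _ = _ := mul_comm _ _

/-! ### The best constant -/

/-- The values of `‖f‖_{p+1}^{p+1}` on nonnegative test functions of energy at most one. -/
def powerValues (c ω p : ℝ) : Set ℝ :=
  {N | ∃ (f : ℝ → ℝ) (hf : IsTest fun x => (f x : ℂ)), (∀ x, 0 ≤ f x) ∧
    energy c ω hf.toH10 ≤ 1 ∧ N = powerNorm p hf.toH10}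

/-- The best constant in `‖u‖_{p+1}^{p+1} ≤ M energy(u)^{(p+1)/2}`. -/
noncomputable def bestConst (c ω p : ℝ) : ℝ := sSup (powerValues c ω p)

theorem bddAbove_powerValues {c ω p : ℝ} (hc0 : 0 < c) (hc : c < 1 / 4) (hω : 0 < ω)
    (hp : 1 < p) : BddAbove (powerValues c ω p) := by
  have hκ : 0 < min (1 - 4 * c) ω := lt_min (by linarith) hω
  refine ⟨(√(1 / min (1 - 4 * c) ω)) ^ (p + 1), ?_⟩
  rintro N ⟨f, hf, -, h1, rfl⟩
  refine (powerNorm_le hp _).trans ?_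
  refine Real.rpow_le_rpow (norm_nonneg _) (Real.le_sqrt_of_sq_le ?_) (by linarith)
  rw [le_div_iff₀ hκ, mul_comm]
  exact (norm_sq_le_energy hc0 _).trans h1

theorem nonempty_powerValues (c ω p : ℝ) : (powerValues c ω p).Nonempty := by
  have h : IsTest fun x : ℝ => (((0 : ℝ → ℝ) x : ℝ) : ℂ) := by
    convert IsTest.zero using 2; simp
  refine ⟨_, 0, h, fun _ => le_rfl, ?_, rfl⟩
  have := h.energy_eq c ω
  rw [this]
  simp

theorem powerNorm_le_of_nonneg_test {c ω p : ℝ} (hc0 : 0 < c) (hc : c < 1 / 4) (hω : 0 < ω)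
    (hp : 1 < p) {f : ℝ → ℝ} (hf : IsTest fun x => (f x : ℂ)) (hf0 : ∀ x, 0 ≤ f x) :
    powerNorm p hf.toH10 ≤ bestConst c ω p * energy c ω hf.toH10 ^ ((p + 1) / 2) := by
  by_cases hz : hf.toH10 = 0
  · have h1 := powerNorm_le hp hf.toH10
    rw [hz, norm_zero, Real.zero_rpow (by linarith)] at h1
    rw [hz]
    have : energy c ω 0 = 0 := by simp [energy]
    rw [this, Real.zero_rpow (by linarith)]
    simpa using h1
  have hE := energy_pos hc0 hc hω hz
  set E := energy c ω hf.toH10 with hEdef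
  -- Normalization to energy one. The claim follows because E is homogeneous of degree 2 and N of
  -- degree p + 1.
  set a : ℝ := (√E)⁻¹ with ha
  have hs : 0 < √E := Real.sqrt_pos.2 hE
  have ha0 : 0 < a := inv_pos.2 hs
  have hg : IsTest fun x => ((a * f x : ℝ) : ℂ) := by
    convert hf.smul (a : ℂ) using 2 with x
    simp
  have hga : hg.toH10 = (a : ℂ) • hf.toH10 := by
    refine Subtype.ext ((WithLp.equiv 2 _).injective (Prod.ext ?_ ?_))
    · refine Lp.ext (hg.toH10_fn.trans (EventuallyEq.trans ?_ (H10.fn_smul (a : ℂ) hf.toH10).symm))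
      filter_upwards [hf.toH10_fn] with x hx
      rw [Pi.smul_apply, hx]; simp
    · refine Lp.ext (hg.toH10_dfn.trans (EventuallyEq.trans ?_
        (Lp.coeFn_smul (a : ℂ) (sndL hf.toH10)).symm))
      filter_upwards [hf.toH10_dfn] with x hx
      rw [Pi.smul_apply, sndL_coe, hx, smul_eq_mul]
      have := ((hf.hasDerivAt x).const_mul (a : ℂ)).deriv
      rw [← this]
      congr 1
      ext y; simp
  have hmem : powerNorm p hg.toH10 ≤ bestConst c ω p := by
    refine le_csSup (bddAbove_powerValues hc0 hc hω hp)
      ⟨_, hg, fun x => mul_nonneg ha0.le (hf0 x), ?_, rfl⟩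
    rw [hga, energy_smul, Complex.norm_real, Real.norm_of_nonneg ha0.le, ha, inv_pow,
      Real.sq_sqrt hE.le, inv_mul_cancel₀ hE.ne']
  rw [hga, powerNorm_smul, Complex.norm_real, Real.norm_of_nonneg ha0.le, ha,
    Real.inv_rpow hs.le, inv_mul_le_iff₀ (by positivity)] at hmem
  refine hmem.trans_eq ?_
  rw [mul_comm, Real.sqrt_eq_rpow, ← Real.rpow_mul hE.le]
  congr 2
  ring

/-- Passing to the regularized modulus lowers the gradient and mass terms and, by Fatou, loses
nothing in the power norm as ε → 0. -/
theorem powerNorm_le_of_test {c ω p : ℝ} (hc0 : 0 < c) (hc : c < 1 / 4) (hω : 0 < ω)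
    (hp : 1 < p) {φ : ℝ → ℂ} (hφ : IsTest φ) :
    powerNorm p hφ.toH10 ≤ bestConst c ω p * energy c ω hφ.toH10 ^ ((p + 1) / 2) := by
  have hM : 0 ≤ bestConst c ω p := by
    obtain ⟨N, hN⟩ := nonempty_powerValues c ω p
    refine le_csSup_of_le (bddAbove_powerValues hc0 hc hω hp) hN ?_
    obtain ⟨f, hf, -, -, rfl⟩ := hN
    exact powerNorm_nonneg _ _
  set ε : ℕ → ℝ := fun n => 1 / ((n : ℝ) + 1) with hε
  have hε0 : ∀ n, 0 < ε n := fun n => by positivity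
  have hεlim : Tendsto ε atTop (𝓝 0) := tendsto_one_div_add_atTop_nhds_zero_nat
  set f : ℕ → ℝ → ℝ := fun n x => √(‖φ x‖ ^ 2 + ε n ^ 2) - ε n with hfdef
  have hf : ∀ n, IsTest fun x => (f n x : ℂ) := fun n => hφ.sqrt_norm_sq (hε0 n)
  have hf0 : ∀ n x, 0 ≤ f n x := fun n x => sqrt_sq_add_sub_nonneg
  have hfle : ∀ n x, f n x ≤ ‖φ x‖ := fun n x => sqrt_sq_add_sub_le (norm_nonneg _) (hε0 n)
  have hflim : ∀ x, Tendsto (fun n => f n x) atTop (𝓝 ‖φ x‖) := by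
    intro x
    have hc : Continuous fun e : ℝ => √(‖φ x‖ ^ 2 + e ^ 2) - e := by fun_prop
    have h : Tendsto (fun n => f n x) atTop (𝓝 (√(‖φ x‖ ^ 2 + 0 ^ 2) - 0)) :=
      (hc.tendsto 0).comp hεlim
    simpa using h
  have hnorm : ∀ n x, ‖((f n x : ℝ) : ℂ)‖ = f n x := fun n x => by
    rw [Complex.norm_real, Real.norm_of_nonneg (hf0 n x)]
  have hdom : Tendsto (fun n => ∫ x, ‖((f n x : ℝ) : ℂ)‖ ^ 2 / x ^ 2 ∂halfLine) atTop
      (𝓝 (∫ x, ‖φ x‖ ^ 2 / x ^ 2 ∂halfLine)) := by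
    refine tendsto_integral_of_dominated_convergence (fun x => ‖φ x‖ ^ 2 / x ^ 2)
      (fun n => (hf n).integrable_norm_sq_div.aestronglyMeasurable.restrict)
      hφ.integrable_norm_sq_div.restrict (fun n => ae_of_all _ fun x => ?_)
      (ae_of_all _ fun x => ?_)
    · rw [Real.norm_of_nonneg (by positivity), hnorm]
      have := hf0 n x
      have := hfle n x
      gcongr
    · simp only [hnorm]
      exact ((hflim x).pow 2).div_const _
  -- The Hardy term has a negative sign, so bounding it through f n ≤ |φ| would go the wrong way. It
  -- is kept as it is and handled by dominated convergence.
  set C : ℕ → ℝ := fun n => ∫ x, ‖deriv φ x‖ ^ 2 ∂halfLine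
    - c * ∫ x, ‖((f n x : ℝ) : ℂ)‖ ^ 2 / x ^ 2 ∂halfLine + ω * ∫ x, ‖φ x‖ ^ 2 ∂halfLine with hC
  have hClim : Tendsto C atTop (𝓝 (energy c ω hφ.toH10)) := by
    rw [hφ.energy_eq]
    exact (tendsto_const_nhds.sub (hdom.const_mul c)).add tendsto_const_nhds
  have hEC : ∀ n, energy c ω (hf n).toH10 ≤ C n := by
    intro n
    rw [(hf n).energy_eq, hC]
    have h1 : ∫ x, ‖deriv (fun x => (f n x : ℂ)) x‖ ^ 2 ∂halfLine
        ≤ ∫ x, ‖deriv φ x‖ ^ 2 ∂halfLine := by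
      refine integral_mono (hf n).deriv.integrable_norm_sq.restrict
        hφ.deriv.integrable_norm_sq.restrict fun x => ?_
      have := norm_deriv_sqrt_norm_sq_le hφ (hε0 n) x
      exact pow_le_pow_left₀ (norm_nonneg _) this 2
    have h2 : ∫ x, ‖((f n x : ℝ) : ℂ)‖ ^ 2 ∂halfLine ≤ ∫ x, ‖φ x‖ ^ 2 ∂halfLine := by
      refine integral_mono (hf n).integrable_norm_sq.restrict
        hφ.integrable_norm_sq.restrict fun x => ?_
      change ‖((f n x : ℝ) : ℂ)‖ ^ 2 ≤ ‖φ x‖ ^ 2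
      rw [hnorm]
      exact pow_le_pow_left₀ (hf0 n x) (hfle n x) 2
    have h3 : ω * ∫ x, ‖((f n x : ℝ) : ℂ)‖ ^ 2 ∂halfLine ≤ ω * ∫ x, ‖φ x‖ ^ 2 ∂halfLine :=
      mul_le_mul_of_nonneg_left h2 hω.le
    simp only
    linarith
  have hfin := integrable_and_integral_le_of_tendsto (μ := halfLine)
    (F := fun n x => ‖(hf n).toH10.fn x‖ ^ (p + 1)) (G := fun x => ‖φ x‖ ^ (p + 1))
    (C := fun n => bestConst c ω p * C n ^ ((p + 1) / 2))
    (C₀ := bestConst c ω p * energy c ω hφ.toH10 ^ ((p + 1) / 2))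
    (fun n => (hf n).toH10.integrable_power hp)
    (fun n => ae_of_all _ fun x => by positivity) (fun n => ?_) ?_ ?_
  · rw [hφ.powerNorm_eq]; exact hfin.2
  · refine (powerNorm_le_of_nonneg_test hc0 hc hω hp (hf n) (hf0 n)).trans ?_
    have := energy_nonneg hc0 hc hω (hf n).toH10
    have := hEC n
    gcongr
  · exact (hClim.rpow_const (Or.inr (by linarith))).const_mul _
  · filter_upwards [ae_all_iff.2 fun n => (hf n).toH10_fn] with x hx
    simp only [hx, hnorm]
    exact (hflim x).rpow_const (Or.inr (by linarith))

/-- The sharp embedding `H¹₀ ⊂ L^{p+1}` with the best constant over nonnegative test functions. -/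
theorem powerNorm_le_bestConst {c ω p : ℝ} (hc0 : 0 < c) (hc : c < 1 / 4) (hω : 0 < ω)
    (hp : 1 < p) (u : H10) :
    powerNorm p u ≤ bestConst c ω p * energy c ω u ^ ((p + 1) / 2) := by
  obtain ⟨φ, hφ, hlim, hae⟩ := exists_test_seq u
  refine (integrable_and_integral_le_of_tendsto (μ := halfLine)
    (F := fun n x => ‖(hφ n).toH10.fn x‖ ^ (p + 1)) (G := fun x => ‖u.fn x‖ ^ (p + 1))
    (fun n => (hφ n).toH10.integrable_power hp)
    (fun n => ae_of_all _ fun x => by positivity)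
    (fun n => powerNorm_le_of_test hc0 hc hω hp (hφ n)) ?_ ?_).2
  · have h := ((continuous_energy c ω).tendsto u).comp hlim
    exact (h.rpow_const (Or.inr (by linarith))).const_mul _
  · filter_upwards [hae, ae_all_iff.2 fun n => (hφ n).toH10_fn] with x hx hx'
    simp only [hx']
    exact hx.norm.rpow_const (Or.inr (by linarith))

/-! ### The calibration of the potential-free problem -/

/-- The calibration `∫₀ᵗ s √(1 - (s/a)^{p-1}) ds`. -/
noncomputable def calib (p a t : ℝ) : ℝ := ∫ s in (0 : ℝ)..t, s * √(1 - (s / a) ^ (p - 1))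

theorem continuous_calib_integrand {p : ℝ} (hp : 1 < p) (a : ℝ) :
    Continuous fun s : ℝ => s * √(1 - (s / a) ^ (p - 1)) := by
  have h : Continuous fun s : ℝ => (s / a) ^ (p - 1) :=
    (continuous_id.div_const a).rpow_const fun _ => Or.inr (by linarith)
  fun_prop

theorem hasDerivAt_calib {p : ℝ} (hp : 1 < p) (a t : ℝ) :
    HasDerivAt (calib p a) (t * √(1 - (t / a) ^ (p - 1))) t :=
  (continuous_calib_integrand hp a).integral_hasStrictDerivAt 0 t |>.hasDerivAt

theorem calib_zero (p a : ℝ) : calib p a 0 = 0 := intervalIntegral.integral_same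

/-- The substitution s = a s' makes the height enter only through a². -/
theorem calib_self {p a : ℝ} (ha : 0 < a) : calib p a a = a ^ 2 * calib p 1 1 := by
  unfold calib
  have h := intervalIntegral.mul_integral_comp_mul_left (a := 0) (b := 1)
    (f := fun s : ℝ => s * √(1 - (s / a) ^ (p - 1))) (c := a)
  rw [mul_zero, mul_one] at h
  have e : ∫ s in (0 : ℝ)..1, a * s * √(1 - (a * s / a) ^ (p - 1))
      = a * ∫ s in (0 : ℝ)..1, s * √(1 - (s / 1) ^ (p - 1)) := by
    rw [← intervalIntegral.integral_const_mul]
    refine intervalIntegral.integral_congr fun s _ => ?_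
    simp only [div_one]
    rw [mul_div_cancel_left₀ _ ha.ne', mul_assoc]
  rw [← h, e]
  ring

theorem calib_le {p a t : ℝ} (hp : 1 < p) (ha : 0 < a) (ht : 0 ≤ t) : calib p a t ≤ t ^ 2 / 2 := by
  have h : calib p a t ≤ ∫ s in (0 : ℝ)..t, s := by
    refine intervalIntegral.integral_mono_on ht
      ((continuous_calib_integrand hp a).intervalIntegrable _ _)
      (continuous_id.intervalIntegrable _ _) fun s hs => ?_
    have h1 : √(1 - (s / a) ^ (p - 1)) ≤ 1 := by
      rw [Real.sqrt_le_one]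
      have : 0 ≤ (s / a) ^ (p - 1) := Real.rpow_nonneg (div_nonneg hs.1 ha.le) _
      linarith
    exact mul_le_of_le_one_right hs.1 h1
  rw [integral_id] at h
  linarith

theorem sq_mul_one_sub_rpow {p a t : ℝ} (hp : 1 < p) (ha : 0 < a) (ht : 0 ≤ t) :
    t ^ 2 * (1 - (t / a) ^ (p - 1)) = t ^ 2 - a ^ (1 - p) * t ^ (p + 1) := by
  rcases ht.eq_or_lt with rfl | ht0
  · rw [Real.zero_rpow (by linarith : p + 1 ≠ 0)]; simp
  · have e1 : t ^ (p + 1) = t ^ (p - 1) * t ^ 2 := by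
      rw [← Real.rpow_natCast, ← Real.rpow_add ht0]; congr 1; push_cast; ring
    have e2 : a ^ (1 - p) = (a ^ (p - 1))⁻¹ := by
      rw [← Real.rpow_neg ha.le]; congr 1; ring
    rw [Real.div_rpow ht ha.le, e1, e2]
    ring

/-- The potential ω(t² - a^(1-p) t^(p+1)) is normalized to vanish at t = a, so it is a square on [0,
a]. The bound is then 2|xy| ≤ x² + y². -/
theorem calibration_pointwise {p a ω t : ℝ} (hp : 1 < p) (ha : 0 < a) (hω : 0 < ω) (ht : 0 ≤ t)
    (hta : t ≤ a) (d : ℝ) : |2 * √ω * (t * √(1 - (t / a) ^ (p - 1)) * d)|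
      ≤ d ^ 2 + (ω * t ^ 2 - ω * a ^ (1 - p) * t ^ (p + 1)) := by
  have h0 : 0 ≤ 1 - (t / a) ^ (p - 1) := by
    rw [sub_nonneg]
    exact Real.rpow_le_one (div_nonneg ht ha.le) ((div_le_one ha).2 hta) (by linarith)
  have e : ω * t ^ 2 - ω * a ^ (1 - p) * t ^ (p + 1)
      = (√ω * (t * √(1 - (t / a) ^ (p - 1)))) ^ 2 := by
    rw [mul_pow, mul_pow, Real.sq_sqrt hω.le, Real.sq_sqrt h0, sq_mul_one_sub_rpow hp ha ht]
    ring
  rw [e, abs_le]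
  constructor
  · nlinarith [sq_nonneg (d + √ω * (t * √(1 - (t / a) ^ (p - 1))))]
  · nlinarith [sq_nonneg (d - √ω * (t * √(1 - (t / a) ^ (p - 1))))]

/-- The integrand dominates both signs of the derivative of 2√ω `calib`(f). Climbing from f(d) to
the maximum and descending to 0 therefore costs at least 2√ω (2 `calib`(max) - `calib`(f d)). No
monotonicity of f is used. -/
theorem calibration_interval {p ω : ℝ} (hp : 1 < p) (hω : 0 < ω) {f f' : ℝ → ℝ}
    (hf : ∀ x, HasDerivAt f (f' x) x) (hf' : Continuous f') (hf0 : ∀ x, 0 ≤ f x) {d x₀ R : ℝ}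
    (hd : d ≤ x₀) (hR : x₀ ≤ R) (hmax : ∀ x, f x ≤ f x₀) (hpos : 0 < f x₀) (hfR : f R = 0) :
    4 * √ω * (f x₀ ^ 2 * calib p 1 1) - √ω * f d ^ 2
      ≤ ∫ x in d..R, (f' x ^ 2 + (ω * f x ^ 2 - ω * f x₀ ^ (1 - p) * f x ^ (p + 1))) := by
  have cf : Continuous f := continuous_iff_continuousAt.2 fun x => (hf x).continuousAt
  have cp : Continuous fun x => f x ^ (p + 1) :=
    cf.rpow_const fun _ => Or.inr (by linarith)
  have ci : Continuous fun x =>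
      f' x ^ 2 + (ω * f x ^ 2 - ω * f x₀ ^ (1 - p) * f x ^ (p + 1)) := by fun_prop
  have cc : Continuous fun x => 2 * √ω * (f x * √(1 - (f x / f x₀) ^ (p - 1)) * f' x) :=
    continuous_const.mul (((continuous_calib_integrand hp _).comp cf).mul hf')
  have hder : ∀ x, HasDerivAt (fun x => 2 * √ω * calib p (f x₀) (f x))
      (2 * √ω * (f x * √(1 - (f x / f x₀) ^ (p - 1)) * f' x)) x := fun x =>
    ((hasDerivAt_calib hp (f x₀) (f x)).comp x (hf x)).const_mul _
  have hpt := fun x => calibration_pointwise hp hpos hω (hf0 x) (hmax x) (f' x)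
  have h1 : 2 * √ω * calib p (f x₀) (f x₀) - 2 * √ω * calib p (f x₀) (f d)
      ≤ ∫ x in d..x₀, (f' x ^ 2 + (ω * f x ^ 2 - ω * f x₀ ^ (1 - p) * f x ^ (p + 1))) := by
    rw [← intervalIntegral.integral_eq_sub_of_hasDerivAt (fun x _ => hder x)
      (cc.intervalIntegrable _ _)]
    exact intervalIntegral.integral_mono_on hd (cc.intervalIntegrable _ _)
      (ci.intervalIntegrable _ _) fun x _ => (le_abs_self _).trans (hpt x)
  have h2 : -(2 * √ω * calib p (f x₀) (f R) - 2 * √ω * calib p (f x₀) (f x₀))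
      ≤ ∫ x in x₀..R, (f' x ^ 2 + (ω * f x ^ 2 - ω * f x₀ ^ (1 - p) * f x ^ (p + 1))) := by
    rw [← intervalIntegral.integral_eq_sub_of_hasDerivAt (fun x _ => hder x)
      (cc.intervalIntegrable _ _), ← intervalIntegral.integral_neg]
    exact intervalIntegral.integral_mono_on hR (cc.neg.intervalIntegrable _ _)
      (ci.intervalIntegrable _ _) fun x _ => (neg_le_abs _).trans (hpt x)
  rw [← intervalIntegral.integral_add_adjacent_intervals (ci.intervalIntegrable d x₀)
    (ci.intervalIntegrable x₀ R)]
  rw [hfR, calib_zero] at h2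
  rw [calib_self hpos] at h1 h2
  have h3 := calib_le hp hpos (hf0 d)
  have h4 : √ω * calib p (f x₀) (f d) ≤ √ω * (f d ^ 2 / 2) := by gcongr
  linarith

/-! ### Energy of a nonnegative test function in terms of its height. -/

theorem IsTest.hasDerivAt_real {f : ℝ → ℝ} (hf : IsTest fun x => (f x : ℂ)) (x : ℝ) :
    HasDerivAt f (_root_.deriv (fun x => (f x : ℂ)) x).re x := by
  have h := Complex.reCLM.hasFDerivAt.comp_hasDerivAt x (hf.hasDerivAt x)
  exact h

theorem IsTest.norm_deriv_real {f : ℝ → ℝ} (hf : IsTest fun x => (f x : ℂ)) (x : ℝ) :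
    ‖_root_.deriv (fun x => (f x : ℂ)) x‖ ^ 2 = (_root_.deriv (fun x => (f x : ℂ)) x).re ^ 2 := by
  have h := (hf.hasDerivAt_real x).ofReal_comp.deriv
  have e : ‖_root_.deriv (fun x => (f x : ℂ)) x‖
      = ‖(((_root_.deriv (fun x => (f x : ℂ)) x).re : ℝ) : ℂ)‖ := congrArg _ h
  rw [e, Complex.norm_real, Real.norm_eq_abs, sq_abs]

/-- The half-line is split at d. On (0, d) Hardy with a free right end absorbs the potential; on (d,
∞) the calibration applies. The terms left explicit (the power integral up to d, the value at d, the
potential beyond d) are those that vanish along a sequence tending to 0 pointwise. -/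
theorem le_energy_of_max {c ω p : ℝ} (hc0 : 0 < c) (hc : c < 1 / 4) (hω : 0 < ω) (hp : 1 < p)
    {f : ℝ → ℝ} (hf : IsTest fun x => (f x : ℂ)) (hf0 : ∀ x, 0 ≤ f x) {d x₀ : ℝ} (hd : 0 < d)
    (hdx : d ≤ x₀) (hmax : ∀ x, f x ≤ f x₀) (hpos : 0 < f x₀) :
    ω * f x₀ ^ (1 - p) * (powerNorm p hf.toH10 - ∫ x in (0 : ℝ)..d, f x ^ (p + 1))
      + 4 * √ω * (f x₀ ^ 2 * calib p 1 1) - √ω * f d ^ 2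
      - c * ∫ x in Ioi d, f x ^ 2 / x ^ 2 ≤ energy c ω hf.toH10 := by
  obtain ⟨R₁, hR₁, h₁⟩ := hf.exists_support_subset
  obtain ⟨R₂, hR₂, h₂⟩ := hf.deriv.exists_support_subset
  obtain ⟨R, hxR, hRR₁, hRR₂⟩ : ∃ R, x₀ ≤ R ∧ R₁ < R ∧ R₂ < R :=
    ⟨max x₀ (max R₁ R₂ + 1), le_max_left _ _,
      lt_of_lt_of_le (by linarith [le_max_left R₁ R₂]) (le_max_right _ _),
      lt_of_lt_of_le (by linarith [le_max_right R₁ R₂]) (le_max_right _ _)⟩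
  have hR0 : 0 ≤ R := by linarith
  have hdR : d ≤ R := hdx.trans hxR
  have hfz : ∀ x, R ≤ x → f x = 0 := fun x hx => by
    have := h₁ x (by linarith); exact_mod_cast this
  have hfz' : ∀ x, R < x → deriv (fun x => (f x : ℂ)) x = 0 := fun x hx => h₂ x (by linarith)
  have cf : Continuous f := continuous_iff_continuousAt.2 fun x => (hf.hasDerivAt_real x).continuousAt
  set g : ℝ → ℝ := fun x => (deriv (fun x => (f x : ℂ)) x).re with hg
  have cg : Continuous g := Complex.continuous_re.comp hf.deriv.continuous
  have cp : Continuous fun x => f x ^ (p + 1) :=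
    cf.rpow_const fun _ => Or.inr (by linarith)
  have hcal := calibration_interval hp hω hf.hasDerivAt_real cg hf0 hdx hxR hmax hpos
    (hfz R le_rfl)
  have hnorm : ∀ x, ‖(f x : ℂ)‖ = f x := fun x => by
    rw [Complex.norm_real, Real.norm_of_nonneg (hf0 x)]
  have hH := hf.hardy_interval hd.le
  have hE := hf.energy_eq c ω
  have hN := hf.powerNorm_eq p
  have hq := hf.integrable_norm_sq_div
  simp only [hf.norm_deriv_real, hnorm] at hH hE hN hq
  have i1 : ∀ a b, IntervalIntegrable (fun x => g x ^ 2) volume a b := fun a b =>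
    (cg.pow 2).intervalIntegrable _ _
  have i2 : ∀ a b, IntervalIntegrable (fun x => f x ^ 2) volume a b := fun a b =>
    (cf.pow 2).intervalIntegrable _ _
  have i3 : ∀ a b, IntervalIntegrable (fun x => f x ^ (p + 1)) volume a b := fun a b =>
    cp.intervalIntegrable _ _
  have s1 : ∫ x, g x ^ 2 ∂halfLine
      = (∫ x in (0 : ℝ)..d, g x ^ 2) + ∫ x in d..R, g x ^ 2 := by
    rw [intervalIntegral.integral_add_adjacent_intervals (i1 _ _) (i1 _ _)]
    exact integral_Ioi_zero_eq_interval hR0 fun x hx => by simp [hg, hfz' x hx]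
  have s2 : ∫ x, f x ^ 2 ∂halfLine
      = (∫ x in (0 : ℝ)..d, f x ^ 2) + ∫ x in d..R, f x ^ 2 := by
    rw [intervalIntegral.integral_add_adjacent_intervals (i2 _ _) (i2 _ _)]
    exact integral_Ioi_zero_eq_interval hR0 fun x hx => by simp [hfz x hx.le]
  have s3 : ∫ x, f x ^ (p + 1) ∂halfLine
      = (∫ x in (0 : ℝ)..d, f x ^ (p + 1)) + ∫ x in d..R, f x ^ (p + 1) := by
    rw [intervalIntegral.integral_add_adjacent_intervals (i3 _ _) (i3 _ _)]
    exact integral_Ioi_zero_eq_interval hR0 fun x hx => by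
      rw [hfz x hx.le, Real.zero_rpow (by linarith)]
  have s4 : ∫ x, f x ^ 2 / x ^ 2 ∂halfLine
      = (∫ x in (0 : ℝ)..d, f x ^ 2 / x ^ 2) + ∫ x in Ioi d, f x ^ 2 / x ^ 2 := by
    rw [intervalIntegral.integral_of_le hd.le, ← setIntegral_union (Ioc_disjoint_Ioi le_rfl)
      measurableSet_Ioi hq.integrableOn hq.integrableOn, Ioc_union_Ioi_eq_Ioi hd.le]
  have s5 : ∫ x in d..R, (g x ^ 2 + (ω * f x ^ 2 - ω * f x₀ ^ (1 - p) * f x ^ (p + 1)))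
      = (∫ x in d..R, g x ^ 2) + (ω * (∫ x in d..R, f x ^ 2)
        - ω * f x₀ ^ (1 - p) * ∫ x in d..R, f x ^ (p + 1)) := by
    rw [intervalIntegral.integral_add (i1 _ _) (((i2 _ _).const_mul _).sub ((i3 _ _).const_mul _)),
      intervalIntegral.integral_sub ((i2 _ _).const_mul _) ((i3 _ _).const_mul _),
      intervalIntegral.integral_const_mul, intervalIntegral.integral_const_mul]
  have hpos2 : 0 ≤ ∫ x in (0 : ℝ)..d, f x ^ 2 :=
    intervalIntegral.integral_nonneg hd.le fun x _ => by positivity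
  have hpos3 : 0 ≤ ∫ x in (0 : ℝ)..d, g x ^ 2 :=
    intervalIntegral.integral_nonneg hd.le fun x _ => by positivity
  rw [s5] at hcal
  rw [hE, hN, s1, s2, s3, s4]
  have h5 : c * ∫ x in (0 : ℝ)..d, f x ^ 2 / x ^ 2 ≤ ∫ x in (0 : ℝ)..d, g x ^ 2 := by
    calc c * ∫ x in (0 : ℝ)..d, f x ^ 2 / x ^ 2 ≤ c * (4 * ∫ x in (0 : ℝ)..d, g x ^ 2) := by gcongr
      _ ≤ _ := by nlinarith
  have h6 := mul_nonneg hω.le hpos2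
  rw [add_sub_cancel_left, mul_add, mul_add]
  linarith

/-! ### The soliton -/

theorem integrable_exp_neg_mul_abs {b : ℝ} (hb : 0 < b) :
    Integrable fun x : ℝ => Real.exp (-b * |x|) := by
  rw [← integrableOn_univ, ← Iic_union_Ioi (a := (0 : ℝ)), integrableOn_union]
  constructor
  · refine (integrableOn_exp_mul_Iic hb 0).congr_fun (fun x hx => ?_) measurableSet_Iic
    simp only [abs_of_nonpos (mem_Iic.1 hx), neg_mul_neg]
  · refine (exp_neg_integrableOn_Ioi 0 hb).congr_fun (fun x hx => ?_) measurableSet_Ioi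
    simp only [abs_of_pos (mem_Ioi.1 hx)]

/-- The soliton profile `sech(b x)^{2/(p-1)}` with `b = (p-1) √ω / 2`. -/
noncomputable def soliton (ω p x : ℝ) : ℝ :=
  Real.cosh ((p - 1) / 2 * √ω * x) ^ (-(2 / (p - 1)))

/-- The derivative of the soliton profile. -/
noncomputable def solitonDeriv (ω p x : ℝ) : ℝ :=
  -√ω * (Real.sinh ((p - 1) / 2 * √ω * x) / Real.cosh ((p - 1) / 2 * √ω * x)) * soliton ω p x

section Soliton

variable {ω p : ℝ}

theorem soliton_pos (x : ℝ) : 0 < soliton ω p x := Real.rpow_pos_of_pos (Real.cosh_pos _) _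

theorem soliton_zero : soliton ω p 0 = 1 := by simp [soliton]

theorem soliton_le_one (hp : 1 < p) (x : ℝ) : soliton ω p x ≤ 1 :=
  Real.rpow_le_one_of_one_le_of_nonpos (Real.one_le_cosh _)
    (neg_nonpos.2 (div_nonneg zero_le_two (by linarith)))

theorem soliton_neg (x : ℝ) : soliton ω p (-x) = soliton ω p x := by
  simp only [soliton, mul_neg, Real.cosh_neg]

theorem soliton_abs (x : ℝ) : soliton ω p |x| = soliton ω p x := by
  rcases abs_choice x with h | h <;> rw [h]
  exact soliton_neg x

theorem soliton_le_soliton (hp : 1 < p) {x y : ℝ} (h : |x| ≤ |y|) :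
    soliton ω p y ≤ soliton ω p x := by
  refine Real.rpow_le_rpow_of_nonpos (Real.cosh_pos _) (Real.cosh_le_cosh.2 ?_)
    (neg_nonpos.2 (div_nonneg zero_le_two (by linarith)))
  rw [abs_mul, abs_mul _ y]
  gcongr

theorem soliton_le_exp (hp : 1 < p) (x : ℝ) :
    soliton ω p x ≤ 2 ^ (2 / (p - 1)) * Real.exp (-√ω * |x|) := by
  have hk : 0 < 2 / (p - 1) := div_pos two_pos (by linarith)
  have hb : 0 ≤ (p - 1) / 2 * √ω := mul_nonneg (by linarith) (Real.sqrt_nonneg _)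
  have h1 : Real.exp ((p - 1) / 2 * √ω * |x|) / 2 ≤ Real.cosh ((p - 1) / 2 * √ω * |x|) := by
    rw [Real.cosh_eq]
    have := Real.exp_pos (-((p - 1) / 2 * √ω * |x|))
    linarith
  have h2 := Real.rpow_le_rpow_of_nonpos (by positivity) h1 (neg_nonpos.2 hk.le)
  rw [← soliton_abs]
  refine h2.trans_eq ?_
  rw [Real.div_rpow (Real.exp_pos _).le zero_le_two, ← Real.exp_mul, Real.rpow_neg zero_le_two,
    div_inv_eq_mul, mul_comm]
  congr 2
  have : p - 1 ≠ 0 := by linarith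
  field_simp

theorem hasDerivAt_soliton (hp : 1 < p) (x : ℝ) :
    HasDerivAt (soliton ω p) (solitonDeriv ω p x) x := by
  have h1 : HasDerivAt (fun x : ℝ => (p - 1) / 2 * √ω * x) ((p - 1) / 2 * √ω) x := by
    simpa using (hasDerivAt_id x).const_mul ((p - 1) / 2 * √ω)
  refine (h1.cosh.rpow_const (p := -(2 / (p - 1)))
    (Or.inl (Real.cosh_pos _).ne')).congr_deriv ?_
  have h0 : p - 1 ≠ 0 := by linarith
  have hc := (Real.cosh_pos ((p - 1) / 2 * √ω * x)).ne'
  rw [solitonDeriv, soliton, Real.rpow_sub_one hc]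
  field_simp

theorem contDiff_soliton : ContDiff ℝ ((⊤ : ℕ∞) : WithTop ℕ∞) (soliton ω p) := by
  unfold soliton
  refine ContDiff.rpow_const_of_ne ?_ fun x => (Real.cosh_pos _).ne'
  exact Real.contDiff_cosh.comp (contDiff_const.mul contDiff_id)

theorem continuous_soliton : Continuous (soliton ω p) := contDiff_soliton.continuous

theorem soliton_rpow_sub_one (hp : 1 < p) (x : ℝ) :
    soliton ω p x ^ (p - 1) = (Real.cosh ((p - 1) / 2 * √ω * x) ^ 2)⁻¹ := by
  have h0 : p - 1 ≠ 0 := by linarith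
  rw [soliton, ← Real.rpow_mul (Real.cosh_pos _).le, ← Real.rpow_natCast,
    ← Real.rpow_neg (Real.cosh_pos _).le]
  congr 1
  push_cast
  field_simp

theorem one_sub_soliton_rpow (hp : 1 < p) (x : ℝ) : 1 - soliton ω p x ^ (p - 1)
    = (Real.sinh ((p - 1) / 2 * √ω * x) / Real.cosh ((p - 1) / 2 * √ω * x)) ^ 2 := by
  rw [soliton_rpow_sub_one hp, div_pow, Real.sinh_sq]
  have hc := (Real.cosh_pos ((p - 1) / 2 * √ω * x)).ne'
  field_simp

theorem soliton_rpow_add_one (x : ℝ) :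
    soliton ω p x ^ (p + 1) = soliton ω p x ^ (p - 1) * soliton ω p x ^ 2 := by
  rw [← Real.rpow_natCast, ← Real.rpow_add (soliton_pos x)]; congr 1; push_cast; ring

/-- The first integral of the soliton equation, i.e. equality in the calibration with height 1. -/
theorem solitonDeriv_sq (hp : 1 < p) (hω : 0 < ω) (x : ℝ) : solitonDeriv ω p x ^ 2
    = ω * (soliton ω p x ^ 2 - soliton ω p x ^ (p + 1)) := by
  rw [solitonDeriv, mul_pow, mul_pow, neg_sq, Real.sq_sqrt hω.le, ← one_sub_soliton_rpow hp,
    soliton_rpow_add_one]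
  ring

theorem integrable_soliton (hp : 1 < p) (hω : 0 < ω) : Integrable (soliton ω p) := by
  have h1 : Integrable fun x : ℝ => Real.exp (-√ω * |x|) :=
    integrable_exp_neg_mul_abs (Real.sqrt_pos.2 hω)
  refine (h1.const_mul (2 ^ (2 / (p - 1)))).mono' continuous_soliton.aestronglyMeasurable
    (ae_of_all _ fun x => ?_)
  rw [Real.norm_of_nonneg (soliton_pos x).le]
  exact soliton_le_exp hp x

theorem soliton_sq_le (hp : 1 < p) (x : ℝ) : soliton ω p x ^ 2 ≤ soliton ω p x := by
  nlinarith [soliton_pos (ω := ω) (p := p) x, soliton_le_one (ω := ω) hp x]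

theorem integrable_soliton_sq (hp : 1 < p) (hω : 0 < ω) :
    Integrable fun x => soliton ω p x ^ 2 := by
  refine (integrable_soliton hp hω).mono' (continuous_soliton.pow 2).aestronglyMeasurable
    (ae_of_all _ fun x => ?_)
  rw [Real.norm_of_nonneg (by positivity)]
  exact soliton_sq_le hp x

theorem integrable_soliton_rpow (hp : 1 < p) (hω : 0 < ω) :
    Integrable fun x => soliton ω p x ^ (p + 1) := by
  refine (integrable_soliton_sq hp hω).mono' (continuous_soliton.rpow_const fun x =>
    Or.inl (soliton_pos x).ne').aestronglyMeasurable (ae_of_all _ fun x => ?_)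
  rw [Real.norm_of_nonneg (Real.rpow_nonneg (soliton_pos x).le _), soliton_rpow_add_one]
  exact mul_le_of_le_one_left (by positivity)
    (Real.rpow_le_one (soliton_pos x).le (soliton_le_one hp x) (by linarith))

theorem integrable_solitonDeriv_sq (hp : 1 < p) (hω : 0 < ω) :
    Integrable fun x => solitonDeriv ω p x ^ 2 := by
  simp only [solitonDeriv_sq hp hω]
  exact ((integrable_soliton_sq hp hω).sub (integrable_soliton_rpow hp hω)).const_mul ω

theorem integral_solitonDeriv_sq (hp : 1 < p) (hω : 0 < ω) : ∫ x, solitonDeriv ω p x ^ 2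
    = ω * ((∫ x, soliton ω p x ^ 2) - ∫ x, soliton ω p x ^ (p + 1)) := by
  simp only [solitonDeriv_sq hp hω]
  rw [integral_const_mul,
    integral_sub (integrable_soliton_sq hp hω) (integrable_soliton_rpow hp hω)]

/-- With φ the soliton, the derivative of φφ' has zero integral. Together with the first integral
this expresses all soliton integrals through the (p+1)-power. -/
theorem two_mul_integral_solitonDeriv_sq (hp : 1 < p) (hω : 0 < ω) :
    2 * ∫ x, solitonDeriv ω p x ^ 2 = (p - 1) / 2 * (ω * ∫ x, soliton ω p x ^ (p + 1)) := by
  set T : ℝ → ℝ := fun x =>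
    Real.sinh ((p - 1) / 2 * √ω * x) / Real.cosh ((p - 1) / 2 * √ω * x) with hT
  have hder : ∀ x, HasDerivAt (fun x => -√ω * T x * soliton ω p x ^ 2)
      (2 * solitonDeriv ω p x ^ 2 - (p - 1) / 2 * (ω * soliton ω p x ^ (p + 1))) x := by
    intro x
    have h1 : HasDerivAt (fun x : ℝ => (p - 1) / 2 * √ω * x) ((p - 1) / 2 * √ω) x := by
      simpa using (hasDerivAt_id x).const_mul ((p - 1) / 2 * √ω)
    have hc := (Real.cosh_pos ((p - 1) / 2 * √ω * x)).ne'
    have h2 : HasDerivAt T ((p - 1) / 2 * √ω * soliton ω p x ^ (p - 1)) x := by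
      refine (h1.sinh.fun_div h1.cosh hc).congr_deriv ?_
      rw [soliton_rpow_sub_one hp]
      rw [div_eq_mul_inv]
      congr 1
      linear_combination (p - 1) / 2 * √ω * Real.cosh_sq_sub_sinh_sq ((p - 1) / 2 * √ω * x)
    refine ((h2.const_mul (-√ω)).fun_mul ((hasDerivAt_soliton hp x).fun_pow 2)).congr_deriv ?_
    have e : solitonDeriv ω p x = -√ω * T x * soliton ω p x := rfl
    have hs : √ω ^ 2 = ω := Real.sq_sqrt hω.le
    rw [soliton_rpow_add_one, e]
    push_cast
    linear_combination (-(p - 1) / 2 * soliton ω p x ^ (p - 1) * soliton ω p x ^ 2) * hs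
  have i1 : Integrable fun x =>
      2 * solitonDeriv ω p x ^ 2 - (p - 1) / 2 * (ω * soliton ω p x ^ (p + 1)) :=
    ((integrable_solitonDeriv_sq hp hω).const_mul 2).sub
      (((integrable_soliton_rpow hp hω).const_mul ω).const_mul _)
  have i2 : Integrable fun x => -√ω * T x * soliton ω p x ^ 2 := by
    refine ((integrable_soliton_sq hp hω).const_mul √ω).mono' ?_ (ae_of_all _ fun x => ?_)
    · exact (continuous_iff_continuousAt.2 fun x => (hder x).continuousAt).aestronglyMeasurable
    · have hT1 : |T x| ≤ 1 := by
        rw [← sq_le_one_iff_abs_le_one, hT, ← one_sub_soliton_rpow hp]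
        linarith [Real.rpow_nonneg (soliton_pos (ω := ω) (p := p) x).le (p - 1)]
      rw [Real.norm_eq_abs, abs_mul, abs_mul, abs_neg, abs_of_nonneg (Real.sqrt_nonneg _),
        abs_of_nonneg (sq_nonneg (soliton ω p x))]
      gcongr
      exact mul_le_of_le_one_right (Real.sqrt_nonneg _) hT1
  have h := integral_eq_zero_of_hasDerivAt_of_integrable hder i1 i2
  rw [integral_sub ((integrable_solitonDeriv_sq hp hω).const_mul 2)
    (((integrable_soliton_rpow hp hω).const_mul ω).const_mul _), integral_const_mul,
    integral_const_mul, integral_const_mul] at h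
  linarith

theorem tendsto_soliton_atTop (hp : 1 < p) (hω : 0 < ω) :
    Tendsto (soliton ω p) atTop (𝓝 0) := by
  have h1 : Tendsto (fun x : ℝ => 2 ^ (2 / (p - 1)) * Real.exp (-√ω * |x|)) atTop (𝓝 0) := by
    rw [← mul_zero ((2 : ℝ) ^ (2 / (p - 1)))]
    refine Tendsto.const_mul _ (Real.tendsto_exp_atBot.comp ?_)
    exact tendsto_abs_atTop_atTop.const_mul_atTop_of_neg (by simpa using hω)
  exact squeeze_zero (fun x => (soliton_pos x).le) (soliton_le_exp hp) h1

/-- For x ≥ 0 the soliton decreases and φ'² is the derivative of -√ω `calib`(φ), so the half-line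
integral telescopes. Evenness supplies the factor 2. -/
theorem integral_solitonDeriv_sq_eq_calib (hp : 1 < p) (hω : 0 < ω) :
    ∫ x, solitonDeriv ω p x ^ 2 = 2 * √ω * calib p 1 1 := by
  have heven : ∀ x, solitonDeriv ω p |x| ^ 2 = solitonDeriv ω p x ^ 2 := by
    intro x
    rw [solitonDeriv_sq hp hω, solitonDeriv_sq hp hω, soliton_abs]
  have h1 : ∫ x, solitonDeriv ω p x ^ 2 = 2 * ∫ x in Ioi (0 : ℝ), solitonDeriv ω p x ^ 2 := by
    rw [← integral_comp_abs (f := fun x => solitonDeriv ω p x ^ 2)]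
    simp only [heven]
  have hder : ∀ x ∈ Ici (0 : ℝ), HasDerivAt (fun x => -√ω * calib p 1 (soliton ω p x))
      (solitonDeriv ω p x ^ 2) x := by
    intro x hx
    refine (((hasDerivAt_calib hp 1 (soliton ω p x)).comp x
      (hasDerivAt_soliton hp x)).const_mul (-√ω)).congr_deriv ?_
    have hb : 0 ≤ (p - 1) / 2 * √ω * x :=
      mul_nonneg (mul_nonneg (by linarith) (Real.sqrt_nonneg _)) hx
    rw [div_one, one_sub_soliton_rpow hp, Real.sqrt_sq (div_nonneg
      (Real.sinh_nonneg_iff.2 hb) (Real.cosh_pos _).le), solitonDeriv]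
    ring
  have hlim : Tendsto (fun x => -√ω * calib p 1 (soliton ω p x)) atTop (𝓝 0) := by
    have hc : ContinuousAt (calib p 1) 0 := (hasDerivAt_calib hp 1 0).continuousAt
    have h := (hc.tendsto.comp (tendsto_soliton_atTop hp hω)).const_mul (-√ω)
    rw [calib_zero, mul_zero] at h
    exact h
  rw [h1, integral_Ioi_of_hasDerivAt_of_tendsto' hder
    (integrable_solitonDeriv_sq hp hω).integrableOn hlim, soliton_zero]
  ring

end Soliton

/-! ### A smooth truncation -/

/-- A smooth nonexpansive function that vanishes on `(-∞, 1]` and is at least `s - 2`. -/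
noncomputable def smoothCut (s : ℝ) : ℝ := ∫ t in (0 : ℝ)..s, Real.smoothTransition (t - 1)

theorem hasDerivAt_smoothCut (s : ℝ) :
    HasDerivAt smoothCut (Real.smoothTransition (s - 1)) s :=
  (Continuous.integral_hasStrictDerivAt
    (Real.smoothTransition.continuous.comp (continuous_id.sub continuous_const)) 0 s).hasDerivAt

theorem contDiff_smoothCut : ContDiff ℝ ((⊤ : ℕ∞) : WithTop ℕ∞) smoothCut := by
  rw [contDiff_infty_iff_deriv]
  refine ⟨fun s => (hasDerivAt_smoothCut s).differentiableAt, ?_⟩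
  rw [funext fun s => (hasDerivAt_smoothCut s).deriv]
  exact Real.smoothTransition.contDiff.comp (contDiff_id.sub contDiff_const)

theorem intervalIntegrable_smoothTransition (a b : ℝ) :
    IntervalIntegrable (fun t => Real.smoothTransition (t - 1)) volume a b :=
  (Real.smoothTransition.continuous.comp
    (continuous_id.sub continuous_const)).intervalIntegrable _ _

theorem smoothCut_eq_zero {s : ℝ} (hs : s ≤ 1) : smoothCut s = 0 := by
  refine intervalIntegral.integral_zero_ae (ae_of_all _ fun t ht => ?_)
  refine Real.smoothTransition.zero_of_nonpos ?_
  have := ht.2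
  have h : max 0 s ≤ 1 := max_le zero_le_one hs
  linarith

theorem smoothCut_nonneg {s : ℝ} (hs : 0 ≤ s) : 0 ≤ smoothCut s :=
  intervalIntegral.integral_nonneg hs fun _ _ => Real.smoothTransition.nonneg _

theorem smoothCut_le {s : ℝ} (hs : 0 ≤ s) : smoothCut s ≤ s := by
  have h : smoothCut s ≤ ∫ _ in (0 : ℝ)..s, (1 : ℝ) :=
    intervalIntegral.integral_mono_on hs (intervalIntegrable_smoothTransition _ _)
      (by simp) fun t _ => Real.smoothTransition.le_one _
  simpa using h

theorem sub_two_le_smoothCut {s : ℝ} (hs : 0 ≤ s) : s - 2 ≤ smoothCut s := by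
  rcases le_total s 2 with h | h
  · linarith [smoothCut_nonneg hs]
  · have h1 : smoothCut s = smoothCut 2 + ∫ t in (2 : ℝ)..s, Real.smoothTransition (t - 1) :=
      (intervalIntegral.integral_add_adjacent_intervals (intervalIntegrable_smoothTransition _ _)
        (intervalIntegrable_smoothTransition _ _)).symm
    have h2 : ∫ t in (2 : ℝ)..s, Real.smoothTransition (t - 1) = ∫ _ in (2 : ℝ)..s, (1 : ℝ) := by
      refine intervalIntegral.integral_congr fun t ht => ?_
      rw [uIcc_of_le h] at ht
      exact Real.smoothTransition.one_of_one_le (by linarith [ht.1])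
    rw [h1, h2]
    have := smoothCut_nonneg (zero_le_two (α := ℝ))
    simp
    linarith

/-! ### The truncated, translated soliton -/

/-- The soliton, truncated at its value at distance `L` from the centre and translated into
`[1, 2L + 1]`. -/
noncomputable def cutSoliton (ω p L x : ℝ) : ℝ :=
  soliton ω p L * smoothCut (soliton ω p (x - (L + 1)) / soliton ω p L)

section CutSoliton

variable {ω p L : ℝ}

theorem cutSoliton_nonneg (x : ℝ) : 0 ≤ cutSoliton ω p L x :=
  mul_nonneg (soliton_pos _).le (smoothCut_nonneg (div_pos (soliton_pos _) (soliton_pos _)).le)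

theorem cutSoliton_le (x : ℝ) : cutSoliton ω p L x ≤ soliton ω p (x - (L + 1)) := by
  have h := smoothCut_le (div_pos (soliton_pos (ω := ω) (p := p) (x - (L + 1)))
    (soliton_pos (ω := ω) (p := p) L)).le
  rwa [le_div_iff₀' (soliton_pos _)] at h

theorem sub_le_cutSoliton (x : ℝ) :
    soliton ω p (x - (L + 1)) - 2 * soliton ω p L ≤ cutSoliton ω p L x := by
  have h := sub_two_le_smoothCut (div_pos (soliton_pos (ω := ω) (p := p) (x - (L + 1)))
    (soliton_pos (ω := ω) (p := p) L)).le
  have h1 := mul_le_mul_of_nonneg_left h (soliton_pos (ω := ω) (p := p) L).le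
  rwa [mul_sub, mul_div_cancel₀ _ (soliton_pos _).ne', mul_comm _ (2 : ℝ)] at h1

/-- At distance at least L from the centre L + 1 the soliton is at most the truncation level. The
extra 1 in the translation keeps the support off the origin. -/
theorem cutSoliton_eq_zero (hp : 1 < p) (hL : 0 < L) {x : ℝ} (hx : x ∉ Icc 1 (2 * L + 1)) :
    cutSoliton ω p L x = 0 := by
  unfold cutSoliton
  rw [smoothCut_eq_zero, mul_zero]
  rw [div_le_one (soliton_pos _)]
  refine soliton_le_soliton hp ?_
  rw [abs_of_pos hL, le_abs]
  by_contra h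
  push Not at h
  exact hx ⟨by linarith, by linarith⟩

theorem hasDerivAt_cutSoliton (hp : 1 < p) (x : ℝ) : HasDerivAt (cutSoliton ω p L)
    (Real.smoothTransition (soliton ω p (x - (L + 1)) / soliton ω p L - 1)
      * solitonDeriv ω p (x - (L + 1))) x := by
  have h1 : HasDerivAt (fun x => soliton ω p (x - (L + 1)) / soliton ω p L)
      (solitonDeriv ω p (x - (L + 1)) / soliton ω p L) x := by
    refine HasDerivAt.div_const ?_ _
    exact (hasDerivAt_soliton hp (x - (L + 1))).comp_sub_const x (L + 1)
  refine (((hasDerivAt_smoothCut _).comp x h1).const_mul (soliton ω p L)).congr_deriv ?_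
  have := (soliton_pos (ω := ω) (p := p) L).ne'
  field_simp

theorem isTest_cutSoliton (hp : 1 < p) (hL : 0 < L) :
    IsTest fun x => (cutSoliton ω p L x : ℂ) := by
  have hsub : tsupport (fun x => (cutSoliton ω p L x : ℂ)) ⊆ Icc 1 (2 * L + 1) := by
    refine closure_minimal (fun x hx => ?_) isClosed_Icc
    by_contra h
    exact hx (by simp [cutSoliton_eq_zero hp hL h])
  refine ⟨?_, isCompact_Icc.of_isClosed_subset (isClosed_tsupport _) hsub,
    hsub.trans fun x hx => lt_of_lt_of_le one_pos hx.1⟩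
  refine Complex.ofRealCLM.contDiff.comp ?_
  exact contDiff_const.mul (contDiff_smoothCut.comp
    ((contDiff_soliton.comp (contDiff_id.sub contDiff_const)).div_const _))

/-- Truncation can only lower the gradient and the mass, while x ≤ 2L + 1 on the support bounds the
gain from the potential below. The loss of mass is controlled by s² - t² = (s - t)(s + t) ≤ 2σ · 2s
with σ the truncation level. -/
theorem energy_cutSoliton_le {c : ℝ} (hc0 : 0 < c) (hp : 1 < p) (hω : 0 < ω) (hL : 0 < L) :
    energy c ω (isTest_cutSoliton (ω := ω) hp hL).toH10
      ≤ (∫ x, solitonDeriv ω p x ^ 2) + ω * (∫ x, soliton ω p x ^ 2)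
        - c / (2 * L + 1) ^ 2
          * ((∫ x, soliton ω p x ^ 2) - 4 * soliton ω p L * ∫ x, soliton ω p x) := by
  set ht := isTest_cutSoliton (ω := ω) hp hL
  have hnorm : ∀ x, ‖(cutSoliton ω p L x : ℂ)‖ = cutSoliton ω p L x := fun x => by
    rw [Complex.norm_real, Real.norm_of_nonneg (cutSoliton_nonneg x)]
  have hz : ∀ x ≤ 0, cutSoliton ω p L x = 0 := fun x hx =>
    cutSoliton_eq_zero hp hL fun h => by linarith [h.1]
  have j1 := ht.integrable_norm_sq
  have j2 := ht.deriv.integrable_norm_sq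
  have j3 := ht.integrable_norm_sq_div
  have hE := ht.energy_eq c ω
  simp only [ht.norm_deriv_real, (ht.hasDerivAt_real _).unique (hasDerivAt_cutSoliton hp _),
    hnorm] at hE j1 j2 j3
  have i1 : Integrable fun x => soliton ω p (x - (L + 1)) ^ 2 :=
    (integrable_soliton_sq hp hω).comp_sub_right (L + 1)
  have i2 : Integrable fun x => solitonDeriv ω p (x - (L + 1)) ^ 2 :=
    (integrable_solitonDeriv_sq hp hω).comp_sub_right (L + 1)
  have i3 : Integrable fun x => soliton ω p (x - (L + 1)) :=
    (integrable_soliton hp hω).comp_sub_right (L + 1)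
  have e1 : ∫ x, (Real.smoothTransition (soliton ω p (x - (L + 1)) / soliton ω p L - 1)
      * solitonDeriv ω p (x - (L + 1))) ^ 2 ∂halfLine ≤ ∫ x, solitonDeriv ω p x ^ 2 := by
    rw [← integral_sub_right_eq_self (fun x => solitonDeriv ω p x ^ 2) (L + 1)]
    refine (setIntegral_le_integral j2 (ae_of_all _ fun x => by positivity)).trans ?_
    refine integral_mono j2 i2 fun x => ?_
    simp only [mul_pow]
    refine mul_le_of_le_one_left (by positivity) ?_
    exact pow_le_one₀ (Real.smoothTransition.nonneg _) (Real.smoothTransition.le_one _)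
  have e2 : ∫ x, cutSoliton ω p L x ^ 2 ∂halfLine ≤ ∫ x, soliton ω p x ^ 2 := by
    rw [← integral_sub_right_eq_self (fun x => soliton ω p x ^ 2) (L + 1)]
    refine (setIntegral_le_integral j1 (ae_of_all _ fun x => by positivity)).trans ?_
    refine integral_mono j1 i1 fun x => ?_
    exact pow_le_pow_left₀ (cutSoliton_nonneg x) (cutSoliton_le x) 2
  have e3 : (∫ x, soliton ω p x ^ 2) - 4 * soliton ω p L * ∫ x, soliton ω p x
      ≤ ∫ x, cutSoliton ω p L x ^ 2 := by
    rw [← integral_sub_right_eq_self (fun x => soliton ω p x ^ 2) (L + 1),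
      ← integral_sub_right_eq_self (soliton ω p) (L + 1), ← integral_const_mul,
      ← integral_sub i1 (i3.const_mul _)]
    refine integral_mono (i1.sub (i3.const_mul _)) j1 fun x => ?_
    have h1 := cutSoliton_nonneg (ω := ω) (p := p) (L := L) x
    have h2 := cutSoliton_le (ω := ω) (p := p) (L := L) x
    have h3 := sub_le_cutSoliton (ω := ω) (p := p) (L := L) x
    have h4 := soliton_pos (ω := ω) (p := p) L
    simp only
    nlinarith [mul_nonneg h4.le (sub_nonneg.2 h2), mul_nonneg (by linarith :
      0 ≤ soliton ω p (x - (L + 1)) + cutSoliton ω p L x) (sub_nonneg.2 h3)]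
  have e4 : 1 / (2 * L + 1) ^ 2 * ∫ x, cutSoliton ω p L x ^ 2
      ≤ ∫ x, cutSoliton ω p L x ^ 2 / x ^ 2 ∂halfLine := by
    rw [integral_halfLine_eq (fun x hx => by simp [hz x hx]), ← integral_const_mul]
    refine integral_mono (j1.const_mul _) j3 fun x => ?_
    simp only
    by_cases hx : x ∈ Icc 1 (2 * L + 1)
    · rw [one_div, ← div_eq_inv_mul]
      have h0 : 0 < x := lt_of_lt_of_le one_pos hx.1
      have := hx.2
      gcongr
    · simp [cutSoliton_eq_zero hp hL hx]
  have e5 : c / (2 * L + 1) ^ 2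
      * ((∫ x, soliton ω p x ^ 2) - 4 * soliton ω p L * ∫ x, soliton ω p x)
      ≤ c * ∫ x, cutSoliton ω p L x ^ 2 / x ^ 2 ∂halfLine := by
    calc _ ≤ c / (2 * L + 1) ^ 2 * ∫ x, cutSoliton ω p L x ^ 2 := by gcongr
      _ = c * (1 / (2 * L + 1) ^ 2 * ∫ x, cutSoliton ω p L x ^ 2) := by ring
      _ ≤ _ := by gcongr
  have e6 := mul_le_mul_of_nonneg_left e2 hω.le
  rw [hE]
  linarith

/-- A convex power lies above its tangent line at s (Bernoulli's inequality). -/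
theorem rpow_sub_le {s t r : ℝ} (hr : 1 ≤ r) (hs : 0 < s) (ht : 0 ≤ t) :
    s ^ r - r * s ^ (r - 1) * (s - t) ≤ t ^ r := by
  have h := one_add_mul_self_le_rpow_one_add (s := t / s - 1)
    (by have := div_nonneg ht hs.le; linarith) hr
  rw [add_sub_cancel, Real.div_rpow ht hs.le, le_div_iff₀ (by positivity)] at h
  refine le_trans (le_of_eq ?_) h
  rw [Real.rpow_sub_one hs.ne']
  field_simp
  ring

/-- The tangent line bounds the loss by (p+1) s^p (s - t). Here s^p ≤ s because the soliton is at
most 1, and s - t is at most twice the truncation level. -/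
theorem le_powerNorm_cutSoliton (hp : 1 < p) (hω : 0 < ω) (hL : 0 < L) :
    (∫ x, soliton ω p x ^ (p + 1)) - 2 * (p + 1) * soliton ω p L * ∫ x, soliton ω p x
      ≤ powerNorm p (isTest_cutSoliton (ω := ω) hp hL).toH10 := by
  set ht := isTest_cutSoliton (ω := ω) hp hL
  have hnorm : ∀ x, ‖(cutSoliton ω p L x : ℂ)‖ = cutSoliton ω p L x := fun x => by
    rw [Complex.norm_real, Real.norm_of_nonneg (cutSoliton_nonneg x)]
  have hz : ∀ x ≤ 0, cutSoliton ω p L x = 0 := fun x hx =>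
    cutSoliton_eq_zero hp hL fun h => by linarith [h.1]
  have i1 : Integrable fun x => soliton ω p (x - (L + 1)) ^ (p + 1) :=
    (integrable_soliton_rpow hp hω).comp_sub_right (L + 1)
  have i3 : Integrable fun x => soliton ω p (x - (L + 1)) :=
    (integrable_soliton hp hω).comp_sub_right (L + 1)
  have hcont : Continuous (cutSoliton ω p L) :=
    continuous_iff_continuousAt.2 fun x => (hasDerivAt_cutSoliton hp x).continuousAt
  have j1 : Integrable fun x => cutSoliton ω p L x ^ (p + 1) := by
    refine i1.mono' (hcont.rpow_const fun _ => Or.inr (by linarith)).aestronglyMeasurable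
      (ae_of_all _ fun x => ?_)
    rw [Real.norm_of_nonneg (Real.rpow_nonneg (cutSoliton_nonneg x) _)]
    exact Real.rpow_le_rpow (cutSoliton_nonneg x) (cutSoliton_le x) (by linarith)
  have hN := ht.powerNorm_eq p
  simp only [hnorm] at hN
  rw [hN, integral_halfLine_eq (fun x hx => by rw [hz x hx, Real.zero_rpow (by linarith)]),
    ← integral_sub_right_eq_self (fun x => soliton ω p x ^ (p + 1)) (L + 1),
    ← integral_sub_right_eq_self (soliton ω p) (L + 1), ← integral_const_mul,
    ← integral_sub i1 (i3.const_mul _)]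
  refine integral_mono (i1.sub (i3.const_mul _)) j1 fun x => ?_
  have h0 := soliton_pos (ω := ω) (p := p) (x - (L + 1))
  have h1 := rpow_sub_le (by linarith : 1 ≤ p + 1) h0
    (cutSoliton_nonneg (ω := ω) (p := p) (L := L) x)
  rw [add_sub_cancel_right] at h1
  refine le_trans ?_ h1
  have h2 : soliton ω p (x - (L + 1)) ^ p ≤ soliton ω p (x - (L + 1)) := by
    conv_rhs => rw [← Real.rpow_one (soliton ω p (x - (L + 1)))]
    exact Real.rpow_le_rpow_of_exponent_ge h0 (soliton_le_one hp _) hp.le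
  have h3 := sub_le_cutSoliton (ω := ω) (p := p) (L := L) x
  have h4 := cutSoliton_le (ω := ω) (p := p) (L := L) x
  have h5 : soliton ω p (x - (L + 1)) ^ p * (soliton ω p (x - (L + 1)) - cutSoliton ω p L x)
      ≤ soliton ω p (x - (L + 1)) * (2 * soliton ω p L) := by
    refine mul_le_mul h2 (by linarith) (by linarith) h0.le
  have h6 := mul_le_mul_of_nonneg_left h5 (by linarith : 0 ≤ p + 1)
  simp only
  linarith

end CutSoliton

/-! ### Strict comparison with the potential-free problem -/

/-- The truncation loss is exponentially small, against a gain of order (2L + 1)⁻². -/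
theorem tendsto_soliton_mul_sq {ω p : ℝ} (hp : 1 < p) (hω : 0 < ω) :
    Tendsto (fun L => soliton ω p L * (2 * L + 1) ^ 2) atTop (𝓝 0) := by
  have hs := Real.sqrt_pos.2 hω
  have h : ∀ n : ℕ, Tendsto (fun x : ℝ => x ^ n * Real.exp (-√ω * x)) atTop (𝓝 0) := by
    intro n
    have h1 := (Real.tendsto_pow_mul_exp_neg_atTop_nhds_zero n).comp
      (tendsto_id.const_mul_atTop hs)
    have h2 := h1.const_mul ((√ω ^ n)⁻¹)
    rw [mul_zero] at h2
    refine h2.congr fun x => ?_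
    simp only [Function.comp_apply, id_eq, mul_pow, neg_mul]
    field_simp
  have h3 : Tendsto (fun x : ℝ => 2 ^ (2 / (p - 1)) * (4 * (x ^ 2 * Real.exp (-√ω * x))
      + 4 * (x ^ 1 * Real.exp (-√ω * x)) + x ^ 0 * Real.exp (-√ω * x))) atTop (𝓝 0) := by
    have := ((((h 2).const_mul 4).add ((h 1).const_mul 4)).add (h 0)).const_mul
      ((2 : ℝ) ^ (2 / (p - 1)))
    simpa using this
  refine squeeze_zero' (Eventually.of_forall fun L =>
    mul_nonneg (soliton_pos L).le (sq_nonneg _)) ?_ h3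
  filter_upwards [eventually_ge_atTop 0] with L hL
  have h4 := soliton_le_exp (ω := ω) hp L
  rw [abs_of_nonneg hL] at h4
  calc soliton ω p L * (2 * L + 1) ^ 2
      ≤ 2 ^ (2 / (p - 1)) * Real.exp (-√ω * L) * (2 * L + 1) ^ 2 := by gcongr
    _ = _ := by ring

/-- The attractive potential makes the best constant larger than that of the full line. -/
theorem soliton_lt_bestConst {c ω p : ℝ} (hc0 : 0 < c) (hc : c < 1 / 4) (hω : 0 < ω)
    (hp : 1 < p) : (∫ x, soliton ω p x ^ (p + 1)) < bestConst c ω p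
      * ((∫ x, solitonDeriv ω p x ^ 2) + ω * ∫ x, soliton ω p x ^ 2) ^ ((p + 1) / 2) := by
  set N := ∫ x, soliton ω p x ^ (p + 1) with hN
  set D := ∫ x, solitonDeriv ω p x ^ 2 with hD
  set A := ∫ x, soliton ω p x ^ 2 with hA
  set I := ∫ x, soliton ω p x with hI
  set M := bestConst c ω p with hM
  have hM0 : 0 ≤ M := by
    obtain ⟨v, hv⟩ := nonempty_powerValues c ω p
    refine le_csSup_of_le (bddAbove_powerValues hc0 hc hω hp) hv ?_
    obtain ⟨f, hf, -, -, rfl⟩ := hv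
    exact powerNorm_nonneg _ _
  have hD0 : 0 ≤ D := integral_nonneg fun _ => by positivity
  have hsupp : ∀ g : ℝ → ℝ, (∀ x, 0 < g x) → Function.support g = univ := fun g hg =>
    eq_univ_of_forall fun x => (hg x).ne'
  have hApos : 0 < A := by
    rw [hA, integral_pos_iff_support_of_nonneg (fun _ => by positivity)
      (integrable_soliton_sq hp hω), hsupp _ fun x => pow_pos (soliton_pos x) 2]
    simp
  have hNpos : 0 < N := by
    rw [hN, integral_pos_iff_support_of_nonneg
      (fun x => Real.rpow_nonneg (soliton_pos x).le _) (integrable_soliton_rpow hp hω),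
      hsupp _ fun x => Real.rpow_pos_of_pos (soliton_pos x) _]
    simp
  set q := D + ω * A with hq
  have hqpos : 0 < q := by positivity
  by_contra! hle
  -- If the strict inequality failed, the gain from the potential, multiplied by (2L + 1)², would be
  -- bounded by the scaled truncation loss. As L → ∞ the left side tends to N c A / q > 0 and the
  -- right side to 0.
  have key : ∀ L : ℝ, 0 < L → N * (c * A / q) - N * (c * 4 * I / q) * soliton ω p L
      ≤ 2 * (p + 1) * I * (soliton ω p L * (2 * L + 1) ^ 2) := by
    intro L hL
    have h1 := le_powerNorm_cutSoliton (ω := ω) hp hω hL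
    have h2 := powerNorm_le_bestConst hc0 hc hω hp (isTest_cutSoliton (ω := ω) hp hL).toH10
    have h3 := energy_cutSoliton_le hc0 hp hω hL
    have h4 := energy_nonneg hc0 hc hω (isTest_cutSoliton (ω := ω) hp hL).toH10
    rw [← hN, ← hI] at h1
    rw [← hD, ← hA, ← hI, ← hq] at h3
    rw [← hM] at h2
    set E := energy c ω (isTest_cutSoliton (ω := ω) hp hL).toH10
    -- When E ≤ q, the exponent (p+1)/2 ≥ 1 gives (E/q)^((p+1)/2) ≤ E/q, which linearizes the power.
    -- When q < E, the estimate of E forces the gain to be nonpositive and the claim is immediate.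
    have h5 : E ^ ((p + 1) / 2) ≤ q ^ ((p + 1) / 2) * (1 - c / (2 * L + 1) ^ 2
        * (A - 4 * soliton ω p L * I) / q) ∨ q < E := by
      by_cases hEq : q < E
      · exact Or.inr hEq
      left
      have h6 : E / q ≤ 1 := (div_le_one hqpos).2 (not_lt.1 hEq)
      have h7 : (E / q) ^ ((p + 1) / 2) ≤ E / q := by
        conv_rhs => rw [← Real.rpow_one (E / q)]
        exact Real.rpow_le_rpow_of_exponent_ge' (div_nonneg h4 hqpos.le) h6 zero_le_one
          (by linarith)
      rw [Real.div_rpow h4 hqpos.le, div_le_iff₀' (by positivity)] at h7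
      refine h7.trans (mul_le_mul_of_nonneg_left ?_ (by positivity))
      rw [div_le_iff₀ hqpos, sub_mul, div_mul_cancel₀ _ hqpos.ne', one_mul]
      exact h3
    have hL2 : 0 < (2 * L + 1) ^ 2 := by positivity
    have hIpos : 0 ≤ I := integral_nonneg fun x => (soliton_pos x).le
    have hσ := (soliton_pos (ω := ω) (p := p) L).le
    have e0 : c / (2 * L + 1) ^ 2 * (A - 4 * soliton ω p L * I) / q * (2 * L + 1) ^ 2
        = c * A / q - c * 4 * I / q * soliton ω p L := by field_simp
    rcases h5 with h5 | h5
    · have h6 : N - 2 * (p + 1) * soliton ω p L * I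
          ≤ N * (1 - c / (2 * L + 1) ^ 2 * (A - 4 * soliton ω p L * I) / q) := by
        have hnn : 0 ≤ 1 - c / (2 * L + 1) ^ 2 * (A - 4 * soliton ω p L * I) / q := by
          by_contra! hneg
          have := mul_neg_of_pos_of_neg (Real.rpow_pos_of_pos hqpos ((p + 1) / 2)) hneg
          have := Real.rpow_nonneg h4 ((p + 1) / 2)
          linarith
        calc _ ≤ M * E ^ ((p + 1) / 2) := h1.trans h2
          _ ≤ M * (q ^ ((p + 1) / 2) * _) := mul_le_mul_of_nonneg_left h5 hM0
          _ = M * q ^ ((p + 1) / 2) * _ := by ring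
          _ ≤ N * _ := mul_le_mul_of_nonneg_right hle hnn
      have h7 := mul_le_mul_of_nonneg_right h6 hL2.le
      have h8 : N * (1 - c / (2 * L + 1) ^ 2 * (A - 4 * soliton ω p L * I) / q) * (2 * L + 1) ^ 2
          = N * (2 * L + 1) ^ 2 - N * (c * A / q - c * 4 * I / q * soliton ω p L) := by
        rw [← e0]; ring
      rw [h8] at h7
      have h9 : N * (c * A / q - c * 4 * I / q * soliton ω p L)
          = N * (c * A / q) - N * (c * 4 * I / q) * soliton ω p L := by ring
      linarith
    · have h6 : c / (2 * L + 1) ^ 2 * (A - 4 * soliton ω p L * I) ≤ 0 := by linarith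
      have h7 : c * A / q - c * 4 * I / q * soliton ω p L ≤ 0 := by
        rw [← e0]
        exact mul_nonpos_of_nonpos_of_nonneg (div_nonpos_of_nonpos_of_nonneg h6 hqpos.le) hL2.le
      have h8 := mul_nonpos_of_nonneg_of_nonpos hNpos.le h7
      have h9 : 0 ≤ 2 * (p + 1) * I * (soliton ω p L * (2 * L + 1) ^ 2) := by positivity
      linarith
  have hlim1 : Tendsto (fun L => N * (c * A / q) - N * (c * 4 * I / q) * soliton ω p L) atTop
      (𝓝 (N * (c * A / q))) := by
    have := (tendsto_const_nhds (x := N * (c * A / q))).sub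
      ((tendsto_soliton_atTop hp hω).const_mul (N * (c * 4 * I / q)))
    simpa using this
  have hlim2 : Tendsto (fun L => 2 * (p + 1) * I * (soliton ω p L * (2 * L + 1) ^ 2)) atTop
      (𝓝 0) := by
    have := (tendsto_soliton_mul_sq hp hω).const_mul (2 * (p + 1) * I)
    simpa using this
  have h := le_of_tendsto_of_tendsto hlim1 hlim2
    ((eventually_gt_atTop 0).mono fun L hL => key L hL)
  have : 0 < N * (c * A / q) := by positivity
  linarith

/-- Set k = (p-1)/2. The soliton identities give q = ωN(1 + k) and 4√ω K = ωNk. With τ = a²q and M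
replaced by the soliton quotient, the right side is (τ^(-k) + kτ)/(1 + k), whose minimum is 1 at τ =
1. Strictness comes from `soliton_lt_bestConst`. -/
theorem one_lt_of_bestConst {c ω p : ℝ} (hc0 : 0 < c) (hc : c < 1 / 4) (hω : 0 < ω)
    (hp : 1 < p) {a : ℝ} (ha : 0 < a) :
    1 < ω * a ^ (1 - p) * bestConst c ω p + 4 * √ω * (a ^ 2 * calib p 1 1) := by
  have h := soliton_lt_bestConst hc0 hc hω hp
  have r1 := integral_solitonDeriv_sq hp hω
  have r2 := two_mul_integral_solitonDeriv_sq hp hω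
  have r3 := integral_solitonDeriv_sq_eq_calib hp hω
  have hD0 : 0 ≤ ∫ x, solitonDeriv ω p x ^ 2 := integral_nonneg fun _ => by positivity
  have hNpos : 0 < ∫ x, soliton ω p x ^ (p + 1) := by
    rw [integral_pos_iff_support_of_nonneg
      (fun x => Real.rpow_nonneg (soliton_pos x).le _) (integrable_soliton_rpow hp hω)]
    rw [eq_univ_of_forall (s := Function.support _) fun x =>
      (Real.rpow_pos_of_pos (soliton_pos x) (p + 1)).ne']
    simp
  set N := ∫ x, soliton ω p x ^ (p + 1)
  set D := ∫ x, solitonDeriv ω p x ^ 2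
  set A := ∫ x, soliton ω p x ^ 2
  set k := (p - 1) / 2 with hk
  have hk0 : 0 < k := by rw [hk]; linarith
  have hq : D + ω * A = ω * N * (1 + k) := by linarith
  have hK : 4 * √ω * calib p 1 1 = ω * N * k := by linarith
  rw [hq] at h
  set q := ω * N * (1 + k) with hqdef
  have hqpos : 0 < q := by positivity
  have hs : (p + 1) / 2 = k + 1 := by rw [hk]; ring
  rw [hs, Real.rpow_add hqpos, Real.rpow_one] at h
  have hτ : 0 < a ^ 2 * q := by positivity
  have e1 : a ^ (1 - p) = (a ^ 2 * q) ^ (-k) * q ^ k := by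
    rw [Real.mul_rpow (by positivity) hqpos.le, mul_assoc, ← Real.rpow_add hqpos, neg_add_cancel,
      Real.rpow_zero, mul_one, ← Real.rpow_natCast a 2, ← Real.rpow_mul ha.le]
    congr 1
    rw [hk]; push_cast; ring
  -- The tangent line of τ ↦ τ^(-k) at τ = 1.
  have h2 : 1 - k * (a ^ 2 * q - 1) ≤ (a ^ 2 * q) ^ (-k) := by
    rw [Real.rpow_def_of_pos hτ]
    have h3 := Real.log_le_sub_one_of_pos hτ
    have h4 := Real.add_one_le_exp (Real.log (a ^ 2 * q) * -k)
    nlinarith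
  have hpos : 0 < (a ^ 2 * q) ^ (-k) := Real.rpow_pos_of_pos hτ _
  have h5 : q < q * (ω * a ^ (1 - p) * bestConst c ω p + 4 * √ω * (a ^ 2 * calib p 1 1)) := by
    calc q = ω * N * (1 + k) := rfl
      _ ≤ ω * N * ((a ^ 2 * q) ^ (-k) + k * (a ^ 2 * q)) := by
          refine mul_le_mul_of_nonneg_left ?_ (by positivity); linarith
      _ = ω * (a ^ 2 * q) ^ (-k) * N + q * (a ^ 2 * (ω * N * k)) := by ring
      _ < ω * (a ^ 2 * q) ^ (-k) * (bestConst c ω p * (q ^ k * q))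
            + q * (a ^ 2 * (ω * N * k)) := by gcongr
      _ = _ := by rw [← hK, e1]; ring
  exact (lt_mul_iff_one_lt_right hqpos).1 h5

/-! ### Weak compactness -/

instance : TopologicalSpace.SeparableSpace H10 := by
  have : Fact ((2 : ENNReal) ≠ ⊤) := ⟨ENNReal.ofNat_ne_top⟩
  have : SecondCountableTopology L2 := inferInstance
  have : SecondCountableTopology L2Pair :=
    (WithLp.homeomorphProd 2 L2 L2).isInducing.secondCountableTopology
  infer_instance

/-- Sequential Banach–Alaoglu in the dual, carried back by the Riesz isometry; separability supplies
the subsequence. -/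
theorem exists_weak_limit {E : Type*} [NormedAddCommGroup E] [InnerProductSpace ℂ E]
    [CompleteSpace E] [TopologicalSpace.SeparableSpace E] {C : ℝ} {v : ℕ → E}
    (hv : ∀ n, ‖v n‖ ≤ C) : ∃ (u : E) (ns : ℕ → ℕ), StrictMono ns ∧
      ∀ l : E →L[ℂ] ℂ, Tendsto (fun n => l (v (ns n))) atTop (𝓝 (l u)) := by
  have hK := WeakDual.isSeqCompact_closedBall ℂ E 0 C
  obtain ⟨y, -, ns, hns, hy⟩ := hK (x := fun n =>
    StrongDual.toWeakDual (InnerProductSpace.toDual ℂ E (v n))) (fun n => by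
      have h : ‖InnerProductSpace.toDual ℂ E (v n)‖ ≤ C :=
        ((InnerProductSpace.toDual ℂ E).norm_map _).trans_le (hv n)
      exact mem_closedBall_zero_iff.2 h)
  refine ⟨(InnerProductSpace.toDual ℂ E).symm (WeakDual.toStrongDual y), ns, hns, fun l => ?_⟩
  obtain ⟨w, rfl⟩ := (InnerProductSpace.toDual ℂ E).surjective l
  have h2 : Tendsto (fun n => inner ℂ (v (ns n)) w) atTop (𝓝 (y w)) :=
    ((WeakDual.eval_continuous w).tendsto y).comp hy
  have h3 := (Complex.continuous_conj.tendsto _).comp h2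
  have e1 : ∀ z : E, InnerProductSpace.toDual ℂ E w z = conj (inner ℂ z w) := fun z =>
    (inner_conj_symm w z).symm
  simp only [e1]
  rw [InnerProductSpace.toDual_symm_apply]
  exact h3

theorem norm_le_of_energy_le_one {c ω : ℝ} (hc0 : 0 < c) (hc : c < 1 / 4) (hω : 0 < ω)
    {u : H10} (hu : energy c ω u ≤ 1) : ‖u‖ ≤ √(1 / min (1 - 4 * c) ω) := by
  have hκ : 0 < min (1 - 4 * c) ω := lt_min (by linarith) hω
  refine Real.le_sqrt_of_sq_le ?_
  rw [le_div_iff₀ hκ, mul_comm]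
  exact (norm_sq_le_energy hc0 _).trans hu

theorem bestConst_pos {c ω p : ℝ} (hc0 : 0 < c) (hc : c < 1 / 4) (hω : 0 < ω) (hp : 1 < p) :
    0 < bestConst c ω p := by
  have h := soliton_lt_bestConst hc0 hc hω hp
  have h0 : 0 ≤ ∫ x, soliton ω p x ^ (p + 1) :=
    integral_nonneg fun x => Real.rpow_nonneg (soliton_pos x).le _
  have h1 : 0 ≤ (∫ x, solitonDeriv ω p x ^ 2) + ω * ∫ x, soliton ω p x ^ 2 :=
    add_nonneg (integral_nonneg fun _ => by positivity)
      (mul_nonneg hω.le (integral_nonneg fun _ => by positivity))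
  exact pos_of_mul_pos_left (h0.trans_lt h) (Real.rpow_nonneg h1 _)

/-! ### Maximizing sequences do not vanish -/

/-- If the sequence vanished pointwise, the potential would drop out in the limit. The height bound
would then contradict the strict advantage of M over the soliton quotient. -/
theorem not_tendsto_zero_of_maximizing {c ω p : ℝ} (hc0 : 0 < c) (hc : c < 1 / 4) (hω : 0 < ω)
    (hp : 1 < p) {g : ℕ → ℝ → ℝ} (hg : ∀ n, IsTest fun x => (g n x : ℂ))
    (hg0 : ∀ n x, 0 ≤ g n x) (hE : ∀ n, energy c ω (hg n).toH10 ≤ 1)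
    (hN : Tendsto (fun n => powerNorm p (hg n).toH10) atTop (𝓝 (bestConst c ω p)))
    (hpt : ∀ x, 0 ≤ x → Tendsto (fun n => g n x) atTop (𝓝 0)) : False := by
  set C := √(1 / min (1 - 4 * c) ω) with hCdef
  have hC0 : 0 ≤ C := Real.sqrt_nonneg _
  have hC : ∀ n, ‖(hg n).toH10‖ ≤ C := fun n => norm_le_of_energy_le_one hc0 hc hω (hE n)
  have hnorm : ∀ n x, ‖(g n x : ℂ)‖ = g n x := fun n x => by
    rw [Complex.norm_real, Real.norm_of_nonneg (hg0 n x)]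
  have hgC : ∀ n x, g n x ≤ C := fun n x => by
    rw [← hnorm n x]; exact ((hg n).norm_le x).trans (hC n)
  have hcont : ∀ n, Continuous (g n) := fun n =>
    continuous_iff_continuousAt.2 fun x => ((hg n).hasDerivAt_real x).continuousAt
  have hsqrt : ∀ n x, 0 ≤ x → g n x ≤ √x * C := fun n x hx => by
    rw [← hnorm n x, ← (hg n).evalL_eq hx]
    refine (norm_evalL_le hx _).trans (mul_le_mul_of_nonneg_left ?_ (Real.sqrt_nonneg _))
    refine le_trans ?_ (hC n)
    refine abs_le_of_sq_le_sq' ?_ (norm_nonneg _) |>.2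
    rw [H10.norm_sq_eq]
    linarith [sq_nonneg ‖fstL (hg n).toH10‖]
  have hmax : ∀ n, ∃ x₀, ∀ x, g n x ≤ g n x₀ := by
    intro n
    refine (hcont n).exists_forall_ge_of_hasCompactSupport ?_
    have := (hg n).compact.comp_left (g := Complex.re) Complex.zero_re
    exact this
  choose x₀ hx₀ using hmax
  obtain ⟨a, ⟨ha0, haC⟩, ns, hns, hlim⟩ := (isCompact_Icc (a := (0 : ℝ)) (b := C)).isSeqCompact
    (x := fun n => g n (x₀ n)) fun n => ⟨hg0 _ _, hgC _ _⟩
  have hMpos := bestConst_pos hc0 hc hω hp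
  have hN' := hN.comp hns.tendsto_atTop
  -- N is at most (maximum)^(p-1) times the mass, so M > 0 prevents the maxima from tending to 0.
  have hMa : bestConst c ω p ≤ a ^ (p - 1) * C ^ 2 := by
    refine le_of_tendsto_of_tendsto' hN'
      ((hlim.rpow_const (Or.inr (by linarith))).mul_const (C ^ 2)) fun n => ?_
    set m := ns n
    have i1 := (hg m).integrable_norm_sq.restrict (s := Ioi 0)
    have h1 := (hg m).norm_toH10_sq
    have h2 : powerNorm p (hg m).toH10
        ≤ ∫ x, g m (x₀ m) ^ (p - 1) * ‖(g m x : ℂ)‖ ^ 2 ∂halfLine := by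
      refine integral_mono_ae ((hg m).toH10.integrable_power hp) (i1.const_mul _) ?_
      filter_upwards [(hg m).toH10_fn] with x hx
      rw [hx, hnorm]
      exact rpow_add_one_le hp (hg0 m x) (hx₀ m x)
    rw [integral_const_mul] at h2
    refine h2.trans (mul_le_mul_of_nonneg_left ?_ (Real.rpow_nonneg (hg0 _ _) _))
    have h3 : ‖(hg m).toH10‖ ^ 2 ≤ C ^ 2 := pow_le_pow_left₀ (norm_nonneg _) (hC m) 2
    have h4 : 0 ≤ ∫ x, ‖deriv (fun x => (g m x : ℂ)) x‖ ^ 2 ∂halfLine :=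
      integral_nonneg fun _ => by positivity
    linarith
  have hapos : 0 < a := by
    rcases ha0.eq_or_lt with h | h
    · rw [← h, Real.zero_rpow (by linarith), zero_mul] at hMa
      linarith
    · exact h
  -- On (0, d] the functions stay below √d C < a, so their maximum points eventually lie beyond d.
  -- There the potential is bounded and x⁻² is integrable.
  obtain ⟨d, hd, hdC⟩ : ∃ d : ℝ, 0 < d ∧ √d * C < a := by
    have h : Tendsto (fun d : ℝ => √d * C) (𝓝[>] 0) (𝓝 (√0 * C)) :=
      ((Real.continuous_sqrt.mul continuous_const).tendsto 0).mono_left nhdsWithin_le_nhds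
    rw [Real.sqrt_zero, zero_mul] at h
    obtain ⟨d, h1, h2⟩ := ((h.eventually (gt_mem_nhds hapos)).and self_mem_nhdsWithin).exists
    exact ⟨d, h2, h1⟩
  have hI : Tendsto (fun n => ∫ x in (0 : ℝ)..d, g n x ^ (p + 1)) atTop (𝓝 0) := by
    have h := intervalIntegral.tendsto_integral_filter_of_dominated_convergence
      (μ := volume) (a := 0) (b := d) (l := atTop) (F := fun n x => g n x ^ (p + 1))
      (f := fun _ => (0 : ℝ)) (fun _ => C ^ (p + 1))
      (Eventually.of_forall fun n => ((hcont n).rpow_const fun _ =>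
        Or.inr (by linarith)).aestronglyMeasurable)
      (Eventually.of_forall fun n => ae_of_all _ fun x _ => by
        rw [Real.norm_of_nonneg (Real.rpow_nonneg (hg0 n x) _)]
        exact Real.rpow_le_rpow (hg0 n x) (hgC n x) (by linarith))
      (by simp) (ae_of_all _ fun x hx => by
        rw [uIoc_of_le hd.le] at hx
        have := (hpt x hx.1.le).rpow_const (p := p + 1) (Or.inr (by linarith))
        rwa [Real.zero_rpow (by linarith)] at this)
    simpa using h
  have hJ : Tendsto (fun n => ∫ x in Ioi d, g n x ^ 2 / x ^ 2) atTop (𝓝 0) := by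
    have hb : IntegrableOn (fun x : ℝ => C ^ 2 * x ^ (-2 : ℝ)) (Ioi d) :=
      (integrableOn_Ioi_rpow_of_lt (by norm_num) hd).const_mul _
    have hmem : ∀ᵐ x ∂(volume.restrict (Ioi d)), d < x := ae_restrict_mem measurableSet_Ioi
    have h := tendsto_integral_of_dominated_convergence (μ := volume.restrict (Ioi d))
      (F := fun n x => g n x ^ 2 / x ^ 2) (f := fun _ => (0 : ℝ)) _
      (fun n => (((hcont n).pow 2).measurable.div
        (measurable_id.pow_const 2)).aestronglyMeasurable) hb
      (fun n => hmem.mono fun x hx => by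
        have hx0 : 0 < x := hd.trans hx
        rw [Real.norm_of_nonneg (by positivity), Real.rpow_neg hx0.le, div_eq_mul_inv]
        have e : x ^ (2 : ℝ) = x ^ 2 := by exact_mod_cast Real.rpow_natCast x 2
        rw [e]
        have := pow_le_pow_left₀ (hg0 n x) (hgC n x) 2
        gcongr)
      (hmem.mono fun x hx => by
        have := ((hpt x (hd.trans hx).le).pow 2).div_const (x ^ 2)
        simpa using this)
    simpa using h
  have hev : ∀ᶠ n in atTop, ω * g (ns n) (x₀ (ns n)) ^ (1 - p) * (powerNorm p (hg (ns n)).toH10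
      - ∫ x in (0 : ℝ)..d, g (ns n) x ^ (p + 1))
      + 4 * √ω * (g (ns n) (x₀ (ns n)) ^ 2 * calib p 1 1) - √ω * g (ns n) d ^ 2
      - c * ∫ x in Ioi d, g (ns n) x ^ 2 / x ^ 2 ≤ 1 := by
    filter_upwards [hlim.eventually (lt_mem_nhds hdC)] with n hn
    set m := ns n
    have hn' : √d * C < g m (x₀ m) := hn
    have h0 : 0 < g m (x₀ m) := lt_of_le_of_lt (mul_nonneg (Real.sqrt_nonneg _) hC0) hn'
    have hdx : d ≤ x₀ m := by
      by_contra! h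
      rcases le_total (x₀ m) 0 with hx | hx
      · have h1 := (hg m).eq_zero_of_nonpos hx
        have h2 : g m (x₀ m) = 0 := by exact_mod_cast h1
        linarith
      · have h1 := hsqrt m _ hx
        have h2 : √(x₀ m) * C ≤ √d * C := by gcongr
        linarith
    exact (le_energy_of_max hc0 hc hω hp (hg m) (hg0 m) hd hdx (hx₀ m) h0).trans (hE m)
  -- All remainder terms vanish in the limit, leaving ω a^(1-p) M + 4√ω a² `calib p 1 1` ≤ 1.
  have hfin := ((((hlim.rpow_const (p := 1 - p) (Or.inl hapos.ne')).const_mul ω).mul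
    (hN'.sub (hI.comp hns.tendsto_atTop))).add (((hlim.pow 2).mul_const
      (calib p 1 1)).const_mul (4 * √ω))).sub
    ((((hpt d hd.le).comp hns.tendsto_atTop).pow 2).const_mul √ω) |>.sub
    ((hJ.comp hns.tendsto_atTop).const_mul c)
  have hle := le_of_tendsto hfin hev
  have := one_lt_of_bestConst hc0 hc hω hp hapos
  simp only [sub_zero, mul_zero, ne_eq, OfNat.ofNat_ne_zero, not_false_eq_true, zero_pow] at hle
  linarith

/-! ### A Brezis–Lieb inequality -/

/-- Tangent line in |z|, then Young's inequality on the cross term |z - a||a|. The ε-term pays for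
the cross term, so the remainder is dominated by |a|² alone. -/
theorem norm_rpow_le_of_sub {p C ε : ℝ} (hp : 1 < p) (hε : 0 < ε) {z a : ℂ} (hz : ‖z‖ ≤ C) :
    ‖z‖ ^ (p + 1) - ‖z - a‖ ^ (p + 1) - ε * ‖z - a‖ ^ 2
      ≤ ((p + 1) * C ^ (p - 1) + ((p + 1) * C ^ (p - 1)) ^ 2 / (4 * ε)) * ‖a‖ ^ 2 := by
  have hC0 : 0 ≤ C := (norm_nonneg z).trans hz
  set K := (p + 1) * C ^ (p - 1) with hK
  have hK0 : 0 ≤ K := mul_nonneg (by linarith) (Real.rpow_nonneg hC0 _)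
  have hzw : ‖z‖ ≤ ‖z - a‖ + ‖a‖ := by simpa using norm_add_le (z - a) a
  have h1 : ‖z‖ ^ (p + 1) - ‖z - a‖ ^ (p + 1) ≤ K * (‖z - a‖ + ‖a‖) * ‖a‖ := by
    rcases (norm_nonneg z).eq_or_lt with h0 | h0
    · rw [← h0, Real.zero_rpow (by linarith)]
      have := Real.rpow_nonneg (norm_nonneg (z - a)) (p + 1)
      have : 0 ≤ K * (‖z - a‖ + ‖a‖) * ‖a‖ := by positivity
      linarith
    · have h2 := rpow_sub_le (by linarith : 1 ≤ p + 1) h0 (norm_nonneg (z - a))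
      rw [add_sub_cancel_right] at h2
      have h3 : ‖z‖ ^ p = ‖z‖ ^ (p - 1) * ‖z‖ := by
        rw [← Real.rpow_add_one h0.ne', sub_add_cancel]
      have h4 : ‖z‖ ^ (p - 1) ≤ C ^ (p - 1) := Real.rpow_le_rpow h0.le hz (by linarith)
      calc ‖z‖ ^ (p + 1) - ‖z - a‖ ^ (p + 1) ≤ (p + 1) * ‖z‖ ^ p * (‖z‖ - ‖z - a‖) := by linarith
        _ ≤ (p + 1) * ‖z‖ ^ p * ‖a‖ := by gcongr; linarith
        _ = (p + 1) * (‖z‖ ^ (p - 1) * ‖z‖) * ‖a‖ := by rw [h3]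
        _ ≤ (p + 1) * (C ^ (p - 1) * (‖z - a‖ + ‖a‖)) * ‖a‖ := by gcongr
        _ = _ := by rw [hK]; ring
  have h5 : K * (‖z - a‖ * ‖a‖) ≤ ε * ‖z - a‖ ^ 2 + K ^ 2 / (4 * ε) * ‖a‖ ^ 2 := by
    have e : ε * ‖z - a‖ ^ 2 + K ^ 2 / (4 * ε) * ‖a‖ ^ 2 - K * (‖z - a‖ * ‖a‖)
        = (2 * ε * ‖z - a‖ - K * ‖a‖) ^ 2 / (4 * ε) := by field_simp; ring
    have : 0 ≤ (2 * ε * ‖z - a‖ - K * ‖a‖) ^ 2 / (4 * ε) := by positivity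
    linarith
  nlinarith

/-- Only the upper half of Brezis–Lieb is needed. The positive part of the defect is dominated by a
fixed multiple of |u|² and tends to 0 almost everywhere, so its integral serves as the error η. -/
theorem powerNorm_le_of_ae_tendsto {p C ε : ℝ} (hp : 1 < p) (hε : 0 < ε) {v : ℕ → H10} {u : H10}
    (hv : ∀ n, ‖v n‖ ≤ C) (hae : ∀ᵐ x ∂halfLine, Tendsto (fun n => (v n).fn x) atTop (𝓝 (u.fn x))) :
    ∃ η : ℕ → ℝ, Tendsto η atTop (𝓝 0) ∧ ∀ n, powerNorm p (v n)
      ≤ powerNorm p (v n - u) + powerNorm p u + ε * ‖v n - u‖ ^ 2 + η n := by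
  set K := (p + 1) * C ^ (p - 1) + ((p + 1) * C ^ (p - 1)) ^ 2 / (4 * ε) with hK
  have hC0 : 0 ≤ C := (norm_nonneg _).trans (hv 0)
  have hK0 : 0 ≤ K := by
    have := Real.rpow_nonneg hC0 (p - 1)
    have : 0 ≤ p + 1 := by linarith
    positivity
  set F : ℕ → ℝ → ℝ := fun n x => ‖(v n).fn x‖ ^ (p + 1) - ‖(v n - u).fn x‖ ^ (p + 1)
    - ‖u.fn x‖ ^ (p + 1) - ε * ‖(v n - u).fn x‖ ^ 2 with hF
  have hFi : ∀ n, Integrable (F n) halfLine := fun n =>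
    ((((v n).integrable_power hp).sub ((v n - u).integrable_power hp)).sub
      (u.integrable_power hp)).sub ((v n - u).integrable_norm_sq.const_mul ε)
  have hsub : ∀ᵐ x ∂halfLine, ∀ n, (v n - u).fn x = (v n).fn x - u.fn x :=
    ae_all_iff.2 fun n => H10.fn_sub (v n) u
  have hlim : Tendsto (fun n => ∫ x, max (F n x) 0 ∂halfLine) atTop
      (𝓝 (∫ _, (0 : ℝ) ∂halfLine)) := by
    refine tendsto_integral_of_dominated_convergence (fun x => K * ‖u.fn x‖ ^ 2)
      (fun n => ((hFi n).pos_part).aestronglyMeasurable) (u.integrable_norm_sq.const_mul K)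
      (fun n => ?_) ?_
    · filter_upwards [hsub, (v n).norm_fn_le] with x hx hxv
      rw [Real.norm_of_nonneg (le_max_right _ _)]
      refine max_le ?_ (by positivity)
      have h1 := norm_rpow_le_of_sub (a := u.fn x) hp hε (hxv.trans (hv n))
      simp only [hF, hx]
      have : 0 ≤ ‖u.fn x‖ ^ (p + 1) := by positivity
      linarith
    · filter_upwards [hsub, hae] with x hx hxv
      simp only [hF, hx]
      have h1 : Tendsto (fun n => (v n).fn x - u.fn x) atTop (𝓝 0) := by
        simpa using hxv.sub_const (u.fn x)
      have hp1 : 0 ≤ p + 1 := by linarith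
      have h2 := ((((hxv.norm.rpow_const (p := p + 1) (Or.inr hp1)).sub
        (h1.norm.rpow_const (p := p + 1) (Or.inr hp1))).sub_const (‖u.fn x‖ ^ (p + 1))).sub
        ((h1.norm.pow 2).const_mul ε)).max (tendsto_const_nhds (x := (0 : ℝ)))
      have e : p + 1 ≠ 0 := by linarith
      simpa [Real.zero_rpow e] using h2
  rw [integral_zero] at hlim
  refine ⟨_, hlim, fun n => ?_⟩
  · have h1 : ∫ x, F n x ∂halfLine ≤ ∫ x, max (F n x) 0 ∂halfLine :=
      integral_mono (hFi n) (hFi n).pos_part fun x => le_max_left _ _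
    have h2 : ∫ x, F n x ∂halfLine = powerNorm p (v n) - powerNorm p (v n - u) - powerNorm p u
        - ε * ‖fstL (v n - u)‖ ^ 2 := by
      rw [norm_fstL_sq]
      simp only [hF]
      rw [integral_sub, integral_sub, integral_sub, integral_const_mul]
      · rfl
      · exact (v n).integrable_power hp
      · exact (v n - u).integrable_power hp
      · exact ((v n).integrable_power hp).sub ((v n - u).integrable_power hp)
      · exact u.integrable_power hp
      · exact (((v n).integrable_power hp).sub ((v n - u).integrable_power hp)).sub
          (u.integrable_power hp)
      · exact (v n - u).integrable_norm_sq.const_mul ε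
    have h3 : ε * ‖fstL (v n - u)‖ ^ 2 ≤ ε * ‖v n - u‖ ^ 2 := by
      gcongr ε * ?_
      rw [H10.norm_sq_eq]; linarith [sq_nonneg ‖sndL (v n - u)‖]
    linarith

/-! ### Existence of an optimizer -/

/-- Splitting the energy between the weak limit and the remainder is strictly wasteful, which
excludes dichotomy. -/
theorem rpow_add_rpow_lt_one {s q : ℝ} (hs : 1 < s) (hq : 0 < q) (hq1 : q < 1) :
    q ^ s + (1 - q) ^ s < 1 := by
  have h1 := Real.rpow_lt_rpow_of_exponent_gt hq hq1 hs
  have h2 := Real.rpow_lt_rpow_of_exponent_gt (by linarith : 0 < 1 - q) (by linarith) hs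
  rw [Real.rpow_one] at h1 h2
  linarith

/-- The best constant is attained at a nonnegative function. -/
theorem exists_optimizer {c ω p : ℝ} (hc0 : 0 < c) (hc : c < 1 / 4) (hω : 0 < ω) (hp : 1 < p) :
    ∃ u : H10, (∀ᵐ x ∂halfLine, 0 ≤ (u.fn x).re ∧ (u.fn x).im = 0) ∧ energy c ω u = 1 ∧
      powerNorm p u = bestConst c ω p := by
  obtain ⟨N, -, hNlim, hNmem⟩ := exists_seq_tendsto_sSup (nonempty_powerValues c ω p)
    (bddAbove_powerValues hc0 hc hω hp)
  choose f hf hf0 hfE hfN using hNmem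
  set C := √(1 / min (1 - 4 * c) ω) with hCdef
  obtain ⟨u, ns, hns, hweak⟩ := exists_weak_limit (v := fun n => (hf n).toH10) (C := C)
    fun n => norm_le_of_energy_le_one hc0 hc hω (hfE n)
  set g : ℕ → ℝ → ℝ := fun n => f (ns n) with hgdef
  have hg : ∀ n, IsTest fun x => (g n x : ℂ) := fun n => hf (ns n)
  set v : ℕ → H10 := fun n => (hg n).toH10 with hvdef
  have hvE : ∀ n, energy c ω (v n) ≤ 1 := fun n => hfE (ns n)
  have hvC : ∀ n, ‖v n‖ ≤ C := fun n => norm_le_of_energy_le_one hc0 hc hω (hvE n)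
  have hvN : Tendsto (fun n => powerNorm p (v n)) atTop (𝓝 (bestConst c ω p)) := by
    refine (hNlim.comp hns.tendsto_atTop).congr fun n => ?_
    exact hfN (ns n)
  have hpt : ∀ x, 0 ≤ x → Tendsto (fun n => (g n x : ℂ)) atTop (𝓝 (evalL x u)) := fun x hx =>
    (hweak (evalL x)).congr fun n => (hf (ns n)).evalL_eq hx
  have hae : ∀ᵐ x ∂halfLine, Tendsto (fun n => (g n x : ℂ)) atTop (𝓝 (u.fn x)) := by
    filter_upwards [u.fn_eq_evalL, ae_halfLine_pos] with x hx hx0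
    rw [hx]
    exact hpt x hx0.le
  have hu0 : u ≠ 0 := by
    rintro rfl
    refine not_tendsto_zero_of_maximizing hc0 hc hω hp hg (fun n => hf0 (ns n)) hvE hvN ?_
    intro x hx
    have h : Tendsto (fun n => g n x) atTop (𝓝 (evalL x 0).re) :=
      (Complex.continuous_re.tendsto _).comp (hpt x hx)
    rwa [map_zero, Complex.zero_re] at h
  have hM := bestConst_pos hc0 hc hω hp
  set q := energy c ω u with hqdef
  have hq0 : 0 < q := energy_pos hc0 hc hω hu0
  -- Expanding E(v n) = E((v n - u) + u) ≤ 1. The cross term tends to 0 by weak convergence, so the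
  -- remainder keeps at most energy 1 - q in the limit.
  set e : ℕ → ℝ := fun n => 1 - q - 2 * (energyForm c ω u (v n - u)).re with hedef
  have he : ∀ n, energy c ω (v n - u) ≤ e n := by
    intro n
    have h := energy_add c ω (v n - u) u
    rw [sub_add_cancel] at h
    have := hvE n
    simp only [hedef]
    linarith
  have helim : Tendsto e atTop (𝓝 (1 - q)) := by
    have h1 : Tendsto (fun n => energyForm c ω u (v n - u)) atTop (𝓝 0) := by
      have := (hweak (energyForm c ω u)).sub_const (energyForm c ω u u)
      rw [sub_self] at this
      refine this.congr fun n => ?_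
      exact ((energyForm c ω u).map_sub _ _).symm
    have h2 := ((Complex.continuous_re.tendsto _).comp h1).const_mul 2
    rw [Complex.zero_re, mul_zero] at h2
    have h3 := (tendsto_const_nhds (x := 1 - q)).sub h2
    rwa [sub_zero] at h3
  have hq1 : q ≤ 1 := by
    have := ge_of_tendsto' helim fun n => (energy_nonneg hc0 hc hω _).trans (he n)
    linarith
  have hmain : bestConst c ω p
      ≤ bestConst c ω p * (1 - q) ^ ((p + 1) / 2) + powerNorm p u := by
    refine le_of_forall_pos_le_add fun ε hε => ?_
    -- The Brezis–Lieb parameter is taken as ε/(C + ‖u‖)², since ‖v n - u‖ ≤ C + ‖u‖.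
    have hD : 0 < (C + ‖u‖) ^ 2 := by
      have := norm_pos_iff.2 hu0
      have : 0 ≤ C := Real.sqrt_nonneg _
      positivity
    obtain ⟨η, hη, hle⟩ := powerNorm_le_of_ae_tendsto (p := p) hp (div_pos hε hD) hvC (u := u) (by
      filter_upwards [hae, ae_all_iff.2 fun n => (hg n).toH10_fn] with x hx hx'
      simpa only [hvdef, hx'] using hx)
    have hlim := (((helim.rpow_const (p := (p + 1) / 2) (Or.inr (by linarith))).const_mul
      (bestConst c ω p)).add_const (powerNorm p u)).add_const ε |>.add hη
    rw [add_zero] at hlim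
    refine le_of_tendsto_of_tendsto' hvN hlim fun n => (hle n).trans ?_
    have h1 := powerNorm_le_bestConst hc0 hc hω hp (v n - u)
    have h2 : energy c ω (v n - u) ^ ((p + 1) / 2) ≤ e n ^ ((p + 1) / 2) :=
      Real.rpow_le_rpow (energy_nonneg hc0 hc hω _) (he n) (by linarith)
    have h3 := mul_le_mul_of_nonneg_left h2 hM.le
    have h4 : ε / (C + ‖u‖) ^ 2 * ‖v n - u‖ ^ 2 ≤ ε := by
      rw [div_mul_eq_mul_div, div_le_iff₀ hD]
      refine mul_le_mul_of_nonneg_left ?_ hε.le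
      refine pow_le_pow_left₀ (norm_nonneg _) ((norm_sub_le _ _).trans ?_) 2
      linarith [hvC n]
    linarith
  have hN := powerNorm_le_bestConst hc0 hc hω hp u
  have hq : q = 1 := by
    by_contra hne
    have h1 := rpow_add_rpow_lt_one (s := (p + 1) / 2) (by linarith) hq0
      (lt_of_le_of_ne hq1 hne)
    have h2 := mul_lt_mul_of_pos_left h1 hM
    linarith
  refine ⟨u, ?_, hq, le_antisymm ?_ ?_⟩
  · filter_upwards [hae] with x hx
    have h1 := (Complex.continuous_re.tendsto _).comp hx
    have h2 := (Complex.continuous_im.tendsto _).comp hx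
    refine ⟨ge_of_tendsto' h1 fun n => ?_, tendsto_nhds_unique h2 ?_⟩
    · simpa using hf0 (ns n) x
    · simp [Function.comp_def]
  · rw [← hqdef, hq, Real.one_rpow, mul_one] at hN
    exact hN
  · rw [hq, sub_self, Real.zero_rpow (by linarith), mul_zero, zero_add] at hmain
    exact hmain

/-! ### The Nehari manifold -/

theorem nehariFunctional_eq (c ω p : ℝ) (u : H10) :
    nehariFunctional c ω p u = energy c ω u - powerNorm p u := by
  have h : hardy c u = ‖sndL u‖ ^ 2 - c * ‖hardyL u‖ ^ 2 := by
    rw [norm_sndL_sq, norm_hardyL_sq, ← integral_const_mul,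
      ← integral_sub u.integrable_dnorm_sq (u.hardy_inequality.1.const_mul c)]
    refine integral_congr_ae (ae_of_all _ fun x => ?_)
    simp only
    ring
  rw [nehariFunctional, h, ← norm_fstL_sq]
  rfl

theorem action_eq (c ω p : ℝ) (u : H10) :
    action c ω p u = 1 / 2 * energy c ω u - 1 / (p + 1) * powerNorm p u := by
  rw [action, ← norm_fstL_sq, ← norm_sndL_sq, ← norm_hardyL_sq, energy, powerNorm]
  ring

theorem action_of_mem_nehariManifold {c ω p : ℝ} {u : H10} (hu : u ∈ nehariManifold c ω p) :
    action c ω p u = (1 / 2 - 1 / (p + 1)) * energy c ω u := by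
  have h := hu.2
  rw [nehariFunctional_eq, sub_eq_zero] at h
  rw [action_eq, ← h]
  ring

/-- On the manifold E = N ≤ M E^((p+1)/2), hence M E^((p-1)/2) ≥ 1. The choice of t turns this into
the stated bound. -/
theorem le_energy_of_mem_nehariManifold {c ω p : ℝ} (hc0 : 0 < c) (hc : c < 1 / 4) (hω : 0 < ω)
    (hp : 1 < p) {t : ℝ} (ht : 0 < t) (htM : t ^ (p - 1) * bestConst c ω p = 1) {u : H10}
    (hu : u ∈ nehariManifold c ω p) : t ^ 2 ≤ energy c ω u := by
  have hE := energy_pos hc0 hc hω hu.1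
  have h := hu.2
  rw [nehariFunctional_eq, sub_eq_zero] at h
  have h1 := powerNorm_le_bestConst hc0 hc hω hp u
  rw [← h, show (p + 1) / 2 = (p - 1) / 2 + 1 by ring, Real.rpow_add_one hE.ne', ← mul_assoc] at h1
  have h2 : 1 ≤ bestConst c ω p * energy c ω u ^ ((p - 1) / 2) :=
    (le_mul_iff_one_le_left hE).1 h1
  have h3 : t ^ (p - 1) ≤ energy c ω u ^ ((p - 1) / 2) := by
    have h4 := Real.rpow_pos_of_pos ht (p - 1)
    calc t ^ (p - 1) ≤ t ^ (p - 1) * (bestConst c ω p * energy c ω u ^ ((p - 1) / 2)) :=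
          le_mul_of_one_le_right h4.le h2
      _ = _ := by rw [← mul_assoc, htM, one_mul]
  have h5 : t ^ (p - 1) = (t ^ 2) ^ ((p - 1) / 2) := by
    rw [← Real.rpow_natCast, ← Real.rpow_mul ht.le]; congr 1; push_cast; ring
  rw [h5] at h3
  exact (Real.rpow_le_rpow_iff (by positivity) hE.le (by linarith)).1 h3

/-! ### The Euler–Lagrange equation -/

/-- The pairing of `|w|^{p-1} w` with `v`. -/
noncomputable def powerPairing (p : ℝ) (w v : H10) : ℂ :=
  ∫ x, ((‖w.fn x‖ ^ (p - 1) : ℝ) : ℂ) * w.fn x * conj (v.fn x) ∂halfLine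

theorem integrable_mul_conj_of_memLp_two {f g : ℝ → ℂ} (hf : MemLp f 2 halfLine)
    (hg : MemLp g 2 halfLine) : Integrable (fun x => f x * conj (g x)) halfLine :=
  hf.integrable_mul hg.star

theorem integrable_powerPairing {p : ℝ} (hp : 1 < p) (w v : H10) :
    Integrable (fun x => ((‖w.fn x‖ ^ (p - 1) : ℝ) : ℂ) * w.fn x * conj (v.fn x)) halfLine := by
  have h1 := integrable_mul_conj_of_memLp_two w.memLp_fn v.memLp_fn
  have hm : AEStronglyMeasurable (fun x => ((‖w.fn x‖ ^ (p - 1) : ℝ) : ℂ)) halfLine := by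
    have hc : Continuous fun z : ℂ => ((‖z‖ ^ (p - 1) : ℝ) : ℂ) :=
      Complex.continuous_ofReal.comp
        (continuous_norm.rpow_const fun _ => Or.inr (by linarith))
    exact hc.comp_aestronglyMeasurable w.memLp_fn.aestronglyMeasurable
  simp only [mul_assoc]
  refine h1.bdd_mul (c := ‖w‖ ^ (p - 1)) hm ?_
  filter_upwards [w.norm_fn_le] with x hx
  rw [Complex.norm_real, Real.norm_of_nonneg (by positivity)]
  exact Real.rpow_le_rpow (norm_nonneg _) hx (by linarith)

theorem inner_L2_eq (f g : L2) : inner ℂ f g = ∫ x, g x * conj (f x) ∂halfLine := by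
  rw [L2.inner_def]
  rfl

theorem weakIntegrand_integrable_and_integral {c ω p : ℝ} (hp : 1 < p) (w v : H10) :
    Integrable (weakIntegrand c ω p w v) halfLine ∧
      ∫ x, weakIntegrand c ω p w v x ∂halfLine = energyForm c ω v w - powerPairing p w v := by
  have i1 : Integrable (fun x => w.dfn x * conj (v.dfn x)) halfLine :=
    integrable_mul_conj_of_memLp_two w.memLp_dfn v.memLp_dfn
  have i2 : Integrable (fun x => hardyL w x * conj (hardyL v x)) halfLine :=
    integrable_mul_conj_of_memLp_two (Lp.memLp _) (Lp.memLp _)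
  have i3 : Integrable (fun x => w.fn x * conj (v.fn x)) halfLine :=
    integrable_mul_conj_of_memLp_two w.memLp_fn v.memLp_fn
  have i4 := integrable_powerPairing hp w v
  have heq : weakIntegrand c ω p w v =ᵐ[halfLine] fun x => w.dfn x * conj (v.dfn x)
      - c * (hardyL w x * conj (hardyL v x)) + ω * (w.fn x * conj (v.fn x))
      - ((‖w.fn x‖ ^ (p - 1) : ℝ) : ℂ) * w.fn x * conj (v.fn x) := by
    filter_upwards [hardyL_coe w, hardyL_coe v] with x h1 h2
    rw [h1, h2, weakIntegrand, map_mul, Complex.conj_ofReal]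
    push_cast
    ring
  have j1 : Integrable (fun x => w.dfn x * conj (v.dfn x)
      - c * (hardyL w x * conj (hardyL v x))) halfLine := i1.sub (i2.const_mul _)
  have j2 : Integrable (fun x => w.dfn x * conj (v.dfn x)
      - c * (hardyL w x * conj (hardyL v x)) + ω * (w.fn x * conj (v.fn x))) halfLine :=
    j1.add (i3.const_mul _)
  refine ⟨(j2.sub i4).congr heq.symm, ?_⟩
  rw [integral_congr_ae heq, integral_sub j2 i4, integral_add j1 (i3.const_mul _),
    integral_sub i1 (i2.const_mul _), integral_const_mul, integral_const_mul, energyForm_apply,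
    inner_L2_eq, inner_L2_eq, inner_L2_eq]
  rfl

/-- The tangent-plane inequality for the convex function |·|^(p+1). Only this one-sided bound is
used later, so no differentiation under the integral occurs. -/
theorem norm_add_rpow_ge {p : ℝ} (hp : 1 < p) (a b : ℂ) :
    ‖a‖ ^ (p + 1) + (p + 1) * (((‖a‖ ^ (p - 1) : ℝ) : ℂ) * a * conj b).re
      ≤ ‖a + b‖ ^ (p + 1) := by
  rcases (norm_nonneg a).eq_or_lt with h0 | h0
  · have ha : a = 0 := norm_eq_zero.1 h0.symm
    simp only [ha, norm_zero, mul_zero, zero_mul, Complex.zero_re, add_zero, zero_add]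
    rw [Real.zero_rpow (by linarith)]
    positivity
  · have h1 := rpow_sub_le (by linarith : 1 ≤ p + 1) h0 (norm_nonneg (a + b))
    rw [add_sub_cancel_right] at h1
    refine le_trans ?_ h1
    have h3 : ‖a‖ ^ p = ‖a‖ ^ (p - 1) * ‖a‖ := by
      rw [← Real.rpow_add_one h0.ne', sub_add_cancel]
    have h4 : ‖a‖ ^ 2 + (a * conj b).re ≤ ‖a‖ * ‖a + b‖ := by
      have h5 : (a * conj (a + b)).re = ‖a‖ ^ 2 + (a * conj b).re := by
        rw [map_add, mul_add, Complex.add_re, Complex.mul_conj, Complex.ofReal_re,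
          Complex.normSq_eq_norm_sq]
      rw [← h5]
      refine (Complex.re_le_norm _).trans_eq ?_
      rw [norm_mul, Complex.norm_conj]
    have h6 : 0 ≤ (p + 1) * ‖a‖ ^ (p - 1) :=
      mul_nonneg (by linarith) (Real.rpow_nonneg h0.le _)
    have h7 := mul_le_mul_of_nonneg_left h4 h6
    rw [mul_assoc, Complex.re_ofReal_mul, h3]
    linarith

theorem powerNorm_add_ge {p : ℝ} (hp : 1 < p) (w v : H10) (ε : ℝ) :
    powerNorm p w + (p + 1) * (ε * (powerPairing p w v).re)
      ≤ powerNorm p ((ε : ℂ) • v + w) := by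
  have i := integrable_powerPairing hp w v
  have e : ε * (powerPairing p w v).re = ∫ x, ε *
      (((‖w.fn x‖ ^ (p - 1) : ℝ) : ℂ) * w.fn x * conj (v.fn x)).re ∂halfLine := by
    rw [integral_const_mul, powerPairing]
    congr 1
    exact (integral_re i).symm
  have i' : Integrable (fun x => (p + 1) * (ε *
      (((‖w.fn x‖ ^ (p - 1) : ℝ) : ℂ) * w.fn x * conj (v.fn x)).re)) halfLine :=
    (i.re.const_mul ε).const_mul (p + 1)
  rw [e, powerNorm, ← integral_const_mul, ← integral_add (w.integrable_power hp) i']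
  refine integral_mono_ae ((w.integrable_power hp).add i')
    (((ε : ℂ) • v + w).integrable_power hp) ?_
  filter_upwards [H10.fn_add ((ε : ℂ) • v) w, H10.fn_smul (ε : ℂ) v] with x h1 h2
  have h3 := norm_add_rpow_ge hp (w.fn x) (ε * v.fn x)
  rw [h1, Pi.add_apply, h2, Pi.smul_apply, smul_eq_mul, add_comm ((ε : ℂ) * v.fn x)]
  refine le_trans (le_of_eq ?_) h3
  rw [map_mul, Complex.conj_ofReal, mul_left_comm _ (ε : ℂ), Complex.re_ofReal_mul]

/-- Along ε ↦ w + εv, replace N by its tangent lower bound. The sharp inequality makes the resulting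
function G nonnegative, and G(0) = 0 by the normalization of t, so G'(0) = 0. -/
theorem energyForm_re_eq_powerPairing_re {c ω p : ℝ} (hc0 : 0 < c) (hc : c < 1 / 4) (hω : 0 < ω)
    (hp : 1 < p) {t : ℝ} (ht : 0 < t) (htM : t ^ (p - 1) * bestConst c ω p = 1) {w : H10}
    (hE : energy c ω w = t ^ 2) (hN : powerNorm p w = t ^ 2) (v : H10) :
    (energyForm c ω w v).re = (powerPairing p w v).re := by
  set b := (energyForm c ω w v).re with hb
  set R := (powerPairing p w v).re with hR
  set M := bestConst c ω p with hM
  have hEε : ∀ ε : ℝ, energy c ω ((ε : ℂ) • v + w)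
      = ε ^ 2 * energy c ω v + t ^ 2 + 2 * (ε * b) := by
    intro ε
    rw [energy_add, energy_smul, hE, map_smul, smul_eq_mul, Complex.re_ofReal_mul,
      Complex.norm_real, Real.norm_eq_abs, sq_abs]
  set G : ℝ → ℝ := fun ε => M * (ε ^ 2 * energy c ω v + t ^ 2 + 2 * (ε * b)) ^ ((p + 1) / 2)
    - (t ^ 2 + (p + 1) * (ε * R)) with hG
  have hG0 : ∀ ε, 0 ≤ G ε := by
    intro ε
    have h1 := powerNorm_add_ge hp w v ε
    have h2 := powerNorm_le_bestConst hc0 hc hω hp ((ε : ℂ) • v + w)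
    rw [hEε] at h2
    rw [hN] at h1
    simp only [hG]
    linarith
  have hpow : M * (t ^ 2) ^ ((p + 1) / 2 - 1) = 1 := by
    have e : (t ^ 2) ^ ((p + 1) / 2 - 1) = t ^ (p - 1) := by
      rw [← Real.rpow_natCast, ← Real.rpow_mul ht.le]
      congr 1
      push_cast
      ring
    rw [e, mul_comm, htM]
  have ht2 : (0 : ℝ) < t ^ 2 := by positivity
  have hGz : G 0 = 0 := by
    have e : (t ^ 2) ^ ((p + 1) / 2) = (t ^ 2) ^ ((p + 1) / 2 - 1) * t ^ 2 := by
      rw [← Real.rpow_add_one ht2.ne', sub_add_cancel]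
    simp only [hG]
    norm_num
    rw [e, ← mul_assoc, hpow]
    ring
  have hmin : IsLocalMin G 0 := Eventually.of_forall fun ε => by rw [hGz]; exact hG0 ε
  have hder : HasDerivAt G (M * (2 * b * ((p + 1) / 2) * (t ^ 2) ^ ((p + 1) / 2 - 1))
      - (p + 1) * R) 0 := by
    have h1 : HasDerivAt (fun ε : ℝ => ε ^ 2 * energy c ω v + t ^ 2 + 2 * (ε * b)) (2 * b) 0 := by
      have h := ((((hasDerivAt_id (0 : ℝ)).fun_pow 2).mul_const (energy c ω v)).add_const
        (t ^ 2)).fun_add (((hasDerivAt_id (0 : ℝ)).mul_const b).const_mul 2)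
      exact h.congr_deriv (by simp)
    have h2 := (h1.rpow_const (p := (p + 1) / 2) (Or.inl (by simpa using ht2.ne'))).const_mul M
    have h3 := h2.fun_sub ((((hasDerivAt_id (0 : ℝ)).mul_const R).const_mul (p + 1)).const_add
      (t ^ 2))
    exact h3.congr_deriv (by simp)
  have h0 := hmin.hasDerivAt_eq_zero hder
  have h1 : M * (2 * b * ((p + 1) / 2) * (t ^ 2) ^ ((p + 1) / 2 - 1)) = (p + 1) * b := by
    linear_combination (p + 1) * b * hpow
  rw [h1, ← mul_sub] at h0
  have := (mul_eq_zero.1 h0).resolve_left (by linarith)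
  linarith

/-- The real variation gives only real parts. Testing with iv as well recovers the imaginary part,
because both terms are conjugate-linear in v. -/
theorem isStationarySolution_of_optimal {c ω p : ℝ} (hc0 : 0 < c) (hc : c < 1 / 4) (hω : 0 < ω)
    (hp : 1 < p) {t : ℝ} (ht : 0 < t) (htM : t ^ (p - 1) * bestConst c ω p = 1) {w : H10}
    (hE : energy c ω w = t ^ 2) (hN : powerNorm p w = t ^ 2) :
    IsStationarySolution c ω p w := by
  intro v
  obtain ⟨h1, h2⟩ := weakIntegrand_integrable_and_integral (c := c) (ω := ω) hp w v
  refine ⟨h1, h2.trans ?_⟩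
  have hsymm : ∀ z : H10, energyForm c ω z w = conj (energyForm c ω w z) := by
    intro z
    simp only [energyForm_apply, map_add, map_sub, map_mul, Complex.conj_ofReal]
    congr 1
    · congr 1
      · exact (inner_conj_symm (sndL z) (sndL w)).symm
      · congr 1
        exact (inner_conj_symm (hardyL z) (hardyL w)).symm
    · congr 1
      exact (inner_conj_symm (fstL z) (fstL w)).symm
  have hre : ∀ z : H10, (energyForm c ω z w - powerPairing p w z).re = 0 := by
    intro z
    rw [hsymm, Complex.sub_re, Complex.conj_re,
      energyForm_re_eq_powerPairing_re hc0 hc hω hp ht htM hE hN, sub_self]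
  have hI : energyForm c ω (Complex.I • v) w - powerPairing p w (Complex.I • v)
      = -Complex.I * (energyForm c ω v w - powerPairing p w v) := by
    have e1 : powerPairing p w (Complex.I • v) = -Complex.I * powerPairing p w v := by
      rw [powerPairing, powerPairing, ← integral_const_mul]
      refine integral_congr_ae ?_
      filter_upwards [H10.fn_smul Complex.I v] with x hx
      rw [hx, Pi.smul_apply, smul_eq_mul, map_mul, Complex.conj_I]
      ring
    rw [e1, hsymm, hsymm v, map_smul, smul_eq_mul, map_mul, Complex.conj_I]
    ring
  refine Complex.ext (hre v) ?_
  have h3 := hre (Complex.I • v)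
  rw [hI] at h3
  simpa using h3

end HalfLineNLS

theorem mainTheorem1 (c ω p : ℝ) (hc0 : 0 < c) (hc : c < 1 / 4) (hω : 0 < ω) (hp : 1 < p) :
    (∀ v : HalfLineNLS.H10,
      Integrable (fun x => ‖v.fn x‖ ^ 2 / x ^ 2) HalfLineNLS.halfLine ∧
      Integrable (fun x => ‖v.fn x‖ ^ (p + 1)) HalfLineNLS.halfLine) ∧
    BddBelow (HalfLineNLS.action c ω p '' HalfLineNLS.nehariManifold c ω p) ∧
    ∃ u : HalfLineNLS.H10,
      u ∈ HalfLineNLS.nehariManifold c ω p ∧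
      u ≠ 0 ∧
      (∀ᵐ x ∂HalfLineNLS.halfLine, 0 ≤ (u.fn x).re ∧ (u.fn x).im = 0) ∧
      HalfLineNLS.action c ω p u = HalfLineNLS.nehariInf c ω p ∧
      HalfLineNLS.IsStationarySolution c ω p u := by
  open HalfLineNLS in
  obtain ⟨u, hu0, huE, huN⟩ := exists_optimizer hc0 hc hω hp
  have hM := bestConst_pos hc0 hc hω hp
  -- The multiple for which E(tu) = t² and N(tu) = t^(p+1) M coincide, i.e. which puts tu on the
  -- Nehari manifold.
  set t : ℝ := bestConst c ω p ^ (-(1 / (p - 1))) with ht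
  have ht0 : 0 < t := Real.rpow_pos_of_pos hM _
  have htM : t ^ (p - 1) * bestConst c ω p = 1 := by
    have : p - 1 ≠ 0 := by linarith
    rw [ht, ← Real.rpow_mul hM.le, show -(1 / (p - 1)) * (p - 1) = -1 by field_simp,
      Real.rpow_neg_one, inv_mul_cancel₀ hM.ne']
  have hnt : ‖(t : ℂ)‖ = t := by rw [Complex.norm_real, Real.norm_of_nonneg ht0.le]
  have hE : energy c ω ((t : ℂ) • u) = t ^ 2 := by rw [energy_smul, huE, hnt, mul_one]
  have hN : powerNorm p ((t : ℂ) • u) = t ^ 2 := by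
    rw [powerNorm_smul, huN, hnt, show p + 1 = (p - 1) + (2 : ℕ) by push_cast; ring,
      Real.rpow_add_natCast ht0.ne']
    linear_combination t ^ 2 * htM
  have hne : (t : ℂ) • u ≠ 0 := by
    intro h
    rw [h] at hE
    have : energy c ω 0 = 0 := by simp [energy]
    rw [this] at hE
    have : 0 < t ^ 2 := by positivity
    linarith
  have hmem : (t : ℂ) • u ∈ nehariManifold c ω p :=
    ⟨hne, by rw [nehariFunctional_eq, hE, hN, sub_self]⟩
  have hcoef : 0 ≤ 1 / 2 - 1 / (p + 1) := by
    rw [sub_nonneg]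
    exact one_div_le_one_div_of_le two_pos (by linarith)
  have hleast : IsLeast (action c ω p '' nehariManifold c ω p) (action c ω p ((t : ℂ) • u)) := by
    refine ⟨mem_image_of_mem _ hmem, ?_⟩
    rintro _ ⟨v, hv, rfl⟩
    rw [action_of_mem_nehariManifold hmem, action_of_mem_nehariManifold hv, hE]
    exact mul_le_mul_of_nonneg_left
      (le_energy_of_mem_nehariManifold hc0 hc hω hp ht0 htM hv) hcoef
  refine ⟨fun v => ⟨v.hardy_inequality.1, v.integrable_power hp⟩, ⟨_, hleast.2⟩, (t : ℂ) • u, hmem, hne,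
    ?_, hleast.csInf_eq.symm, isStationarySolution_of_optimal hc0 hc hω hp ht0 htM hE hN⟩
  filter_upwards [hu0, H10.fn_smul (t : ℂ) u] with x hx hx'
  rw [hx', Pi.smul_apply, smul_eq_mul, Complex.re_ofReal_mul, Complex.im_ofReal_mul, hx.2]
  exact ⟨mul_nonneg ht0.le hx.1, mul_zero _⟩
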